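/- Let $T>0$, $\mathbb T=\mathbb R/\mathbb Z$, and let $u_0:\mathbb T\to\mathbb R$ be smooth. Consider $$J=\sup_W\Big\{\int_{[0,T]\times\mathbb T}-\frac{(\partial_tW)^2}{2(1-\partial_xW)}-\int_{\mathbb T}W(0,\cdot)u_0\Big\},$$ where the supremum runs over all smooth functions $W=W(t,x)$ on $[0,T]\times\mathbb T$ with $W(T,\cdot)=0$, $\partial_xW\le1$, and $\partial_tW=0$ wherever $\partial_xW=1$ (at such points the integrand is $0$; the value is $-\infty$ if the first integral diverges). Let $\mathcal W$ be the class of all functions $W$ of bounded variation on $[0,T]\times\mathbb T$ (integrable, with distributional derivatives $\partial_tW$, $\partial_xW$ on $(0,T)\times\mathbb T$ that are bounded signed Borel measures) that are uniformly continuous in $t\in[0,T]$ with values in the distributions on $\mathbb T$ (each $W(t,\cdot)$ being an integrable function) and satisfy $\partial_xW\le1$ as measures and $W(T,\cdot)=0$. For $W\in\mathcal W$, put $\rho=dt\,dx-\partial_xW\ge0$ and $q=\partial_tW$, and define $$\int_{[0,T]\times\mathbb T}\frac{(\partial_tW)^2}{2(1-\partial_xW)}=\int\frac{v^2}{2}\,d\rho\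 \text{ if } q=v\rho \text{ for some } v\in L^1(\rho),\qquad =+\infty\ \text{ otherwise.}$$ Then: (i) Every smooth competitor belongs to $\mathcal W$, and there the objective defined through measures has the same value as the original one. (ii) In both classes, replacing $-\int_{\mathbb T}W(0,\cdot)u_0$ by $\int_{[0,T]\times\mathbb T}u_0\,\partial_tW$ does not change the problem: the supremum over smooth competitors is the same, and the two objectives coincide on $\mathcal W$. (iii) The supremum of the objective over $\mathcal W$ equals $J$, and it is attained by some $W\in\mathcal W$. -/

import Mathlib

open MeasureTheory Set
open scoped ENNReal ContDiff

noncomputable section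

namespace BurgersMax

/-- Lebesgue measure on the open slab `(0,T) × 𝕋`, seen as a measure on `ℝ × 𝕋`. -/
abbrev slab (T : ℝ) : Measure (ℝ × UnitAddCircle) :=
  ((volume : Measure ℝ).restrict (Ioo 0 T)).prod (volume : Measure UnitAddCircle)

/-- Derivative of a function on the torus `𝕋 = ℝ/ℤ`. -/
def torusDeriv (f : UnitAddCircle → ℝ) (x : UnitAddCircle) : ℝ :=
  deriv (fun h : ℝ => f (x + (h : UnitAddCircle))) 0

/-- Smooth functions on the torus: the `1`-periodic lift to `ℝ` is smooth. -/
def TorusSmooth (f : UnitAddCircle → ℝ) : Prop :=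
  ContDiff ℝ ∞ (fun x : ℝ => f (x : UnitAddCircle))

/-! ### The problem for smooth functions -/

/-- Smooth competitors on `[0,T] × 𝕋` (smooth up to the boundary): `W(T,·) = 0`, `∂ₓW ≤ 1`, and
`∂ₜW = 0` wherever `∂ₓW = 1`. Only the values of `W` for `t ∈ [0,T]` matter. -/
structure SmoothCompetitor (T : ℝ) (W : ℝ → UnitAddCircle → ℝ) : Prop where
  smooth : ContDiffOn ℝ ∞ (fun z : ℝ × ℝ => W z.1 (z.2 : UnitAddCircle)) (Icc 0 T ×ˢ univ)
  final : ∀ x, W T x = 0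
  deriv_le : ∀ t ∈ Icc 0 T, ∀ x, torusDeriv (W t) x ≤ 1
  deriv_eq : ∀ t ∈ Icc 0 T, ∀ x, torusDeriv (W t) x = 1 →
    derivWithin (fun s => W s x) (Icc 0 T) t = 0

/-- `∫ (∂ₜW)² / (2 (1 - ∂ₓW))` over `[0,T] × 𝕋`, possibly `+∞`. For a smooth competitor the
integrand is `0 / 0 = 0` where `∂ₓW = 1`, which is the convention of the problem. -/
def smoothAction (T : ℝ) (W : ℝ → UnitAddCircle → ℝ) : ℝ≥0∞ :=
  ∫⁻ z : ℝ × UnitAddCircle,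
    ENNReal.ofReal ((derivWithin (fun s => W s z.2) (Icc 0 T) z.1) ^ 2
      / (2 * (1 - torusDeriv (W z.1) z.2))) ∂(slab T)

/-- `∫ -(∂ₜW)² / (2 (1 - ∂ₓW)) - ∫ W(0,·) u₀`, a value in `[-∞, +∞)`. -/
def smoothObjective (T : ℝ) (u₀ : UnitAddCircle → ℝ) (W : ℝ → UnitAddCircle → ℝ) : EReal :=
  -(smoothAction T W : EReal) - ((∫ x, W 0 x * u₀ x : ℝ) : EReal)

/-- `∫ -(∂ₜW)² / (2 (1 - ∂ₓW)) + ∂ₜW u₀`, a value in `[-∞, +∞)`. -/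
def smoothObjective' (T : ℝ) (u₀ : UnitAddCircle → ℝ) (W : ℝ → UnitAddCircle → ℝ) : EReal :=
  -(smoothAction T W : EReal) +
    ((∫ z : ℝ × UnitAddCircle,
      derivWithin (fun s => W s z.2) (Icc 0 T) z.1 * u₀ z.2 ∂(slab T) : ℝ) : EReal)

/-- The optimal value `J` of the Burgers problem, a supremum over smooth competitors. -/
def optimalValue (T : ℝ) (u₀ : UnitAddCircle → ℝ) : EReal :=
  sSup {c : EReal | ∃ W, SmoothCompetitor T W ∧ c = smoothObjective T u₀ W}

/-- The same supremum for the second form of the objective. -/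
def optimalValue' (T : ℝ) (u₀ : UnitAddCircle → ℝ) : EReal :=
  sSup {c : EReal | ∃ W, SmoothCompetitor T W ∧ c = smoothObjective' T u₀ W}

/-! ### Functions of bounded variation on `(0,T) × 𝕋` -/

/-- Smooth test functions on `ℝ × 𝕋` with compact support in `(0,T) × 𝕋`. -/
structure IsTestFunction (T : ℝ) (φ : ℝ × UnitAddCircle → ℝ) : Prop where
  smooth : ContDiff ℝ ∞ (fun z : ℝ × ℝ => φ (z.1, (z.2 : UnitAddCircle)))
  compact : HasCompactSupport φ
  support : tsupport φ ⊆ Ioo 0 T ×ˢ univ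

/-- The finite signed measure `q`, carried by `(0,T) × 𝕋`, is the distributional derivative `∂ₜW`
on `(0,T) × 𝕋`. -/
def IsTimeDeriv (T : ℝ) (W : ℝ → UnitAddCircle → ℝ)
    (q : SignedMeasure (ℝ × UnitAddCircle)) : Prop :=
  q.restrict (Ioo 0 T ×ˢ univ) = q ∧
  ∀ φ, IsTestFunction T φ →
    ∫ᵛ z, φ z ∂<•q = -∫ z, W z.1 z.2 * deriv (fun s => φ (s, z.2)) z.1 ∂(slab T)

/-- The finite signed measure `p`, carried by `(0,T) × 𝕋`, is the distributional derivative `∂ₓW`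
on `(0,T) × 𝕋`. -/
def IsSpaceDeriv (T : ℝ) (W : ℝ → UnitAddCircle → ℝ)
    (p : SignedMeasure (ℝ × UnitAddCircle)) : Prop :=
  p.restrict (Ioo 0 T ×ˢ univ) = p ∧
  ∀ φ, IsTestFunction T φ →
    ∫ᵛ z, φ z ∂<•p = -∫ z, W z.1 z.2 * torusDeriv (fun y => φ (z.1, y)) z.2 ∂(slab T)

/-- The generalized class: functions `W` of bounded variation on `[0,T] × 𝕋` (integrable, with
distributional derivatives `∂ₜW = q` and `∂ₓW = p` that are bounded Borel measures), uniformly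
continuous in `t ∈ [0,T]` with values in the distributions on `𝕋`, with `∂ₓW ≤ 1` as measures and
`W(T,·) = 0`. -/
structure BVCompetitor (T : ℝ) (W : ℝ → UnitAddCircle → ℝ)
    (q p : SignedMeasure (ℝ × UnitAddCircle)) : Prop where
  integrable : Integrable (fun z : ℝ × UnitAddCircle => W z.1 z.2) (slab T)
  integrable_slice : ∀ t ∈ Icc 0 T, Integrable (W t)
  timeDeriv : IsTimeDeriv T W q
  spaceDeriv : IsSpaceDeriv T W p
  uniformContinuous : ∀ ψ : UnitAddCircle → ℝ, TorusSmooth ψ →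
    UniformContinuousOn (fun t : ℝ => ∫ x, W t x * ψ x) (Icc 0 T)
  deriv_le : p ≤ (slab T).toSignedMeasure
  final : W T =ᵐ[volume] 0

/-- `∫ q² / (2 r)` for finite signed measures: `∫ v² / 2 dr` if `r` is nonnegative and `q = v r`
(such a `v` is unique `r`-almost everywhere), and `+∞` if `r` is not nonnegative or `q` is not
absolutely continuous with respect to `r`. -/
def measureAction {X : Type*} [MeasurableSpace X] (r q : SignedMeasure X) : ℝ≥0∞ :=
  ⨅ (μ : Measure X) (_ : IsFiniteMeasure μ) (v : X → ℝ)
    (_ : μ.toSignedMeasure = r ∧ Integrable v μ ∧ q = μ.withDensityᵥ v),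
    ∫⁻ z, ENNReal.ofReal (v z ^ 2 / 2) ∂μ

/-- `∫ -(∂ₜW)² / (2 (1 - ∂ₓW)) - ∫ W(0,·) u₀` for `∂ₜW = q` and `∂ₓW = p`. -/
def bvObjective (T : ℝ) (u₀ : UnitAddCircle → ℝ) (W : ℝ → UnitAddCircle → ℝ)
    (q p : SignedMeasure (ℝ × UnitAddCircle)) : EReal :=
  -(measureAction ((slab T).toSignedMeasure - p) q : EReal) - ((∫ x, W 0 x * u₀ x : ℝ) : EReal)

/-- `∫ -(∂ₜW)² / (2 (1 - ∂ₓW)) + ∂ₜW u₀` for `∂ₜW = q` and `∂ₓW = p`. -/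
def bvObjective' (T : ℝ) (u₀ : UnitAddCircle → ℝ)
    (q p : SignedMeasure (ℝ × UnitAddCircle)) : EReal :=
  -(measureAction ((slab T).toSignedMeasure - p) q : EReal) +
    ((∫ᵛ z, u₀ z.2 ∂<•q : ℝ) : EReal)

end BurgersMax

end

/-!
Write `ρ = 1 - ∂ₓW` (a nonnegative measure, `massMeasure` in the smooth case) and `q = ∂ₜW = vρ`, so
that the action is `∫ v² / 2 dρ`. Smooth competitors are generalized competitors with the same
objective because the pair `(ρ, v)` is determined by `(∂ₓW, ∂ₜW)` (`measureAction_eq`). The two forms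
of the linear term agree because the distributional identity for `∂ₜW` extends, by cutoffs in time and
the continuity of `t ↦ ∫ W(t,·) b`, to test functions that do not vanish at times `0` and `T`; the
boundary term at `T` disappears with `W(T,·)` (`BVCompetitor.integral_timeDeriv`).

*The generalized supremum is at most the smooth one* (`BVCompetitor.bvObjective_le`). Let `W` have
finite action, and mollify it with a kernel `k = η(s - t) ζ(x - y)`, where `η` is supported in
`(0, ∞)`. As `W(T,·) = 0`, the result is smooth on `[0,T] × 𝕋` and vanishes at time `T`, with
`∂ₜ = ∫ k v dρ` and `1 - ∂ₓ ≥ ∫ k dρ ≥ 0`; the difference is the mass of `k` beyond time `T`. By the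
Cauchy–Schwarz inequality `(∫ k v dρ)² ≤ (∫ k v² dρ) (∫ k dρ)`. Hence the time derivative vanishes
where `1 - ∂ₓ = 0`, so the mollification is a smooth competitor, and its action is at most that of
`W`. The linear term converges as the kernels concentrate.

*The supremum is attained* (`exists_optimalValue_le_bvObjective`). Half of the action dominates the
linear term up to a constant, so a maximizing sequence of smooth competitors has bounded action; it
is then bounded in the supremum norm, because `∂ₓW ≤ 1` bounds the oscillation in space and the
action bounds the mean. Along an ultrafilter, `ρ` converges weakly as a measure on the compact set
`[0,T] × 𝕋`, and `W` converges weakly to some `V` in `L²`. The momenta `vρ` converge on test functions to a functional bounded by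
the limit of the actions, so by the theorems of Hahn–Banach and Riesz the limit is again of the form
`vρ`, with `∫ v² / 2 dρ` at most the limit of the actions (`exists_weakCompetitor`). It remains to
choose the values of `V` at every time: integrating `∂ₜW = vρ` from `t` to `T` prescribes the pairing
of the slice at time `t` with each smooth function (`slicePairing`), continuously in `t` because the
time marginal of `ρ` is Lebesgue measure. Almost every slice of `V` has these pairings, and the Riesz
theorem provides slices at the remaining times (`IsWeakCompetitor.exists_bvCompetitor`).
-/

open Filter Topology

namespace BurgersMax

/-! ### Calculus on the torus -/

instance isProbabilityMeasure_torus : IsProbabilityMeasure (volume : Measure UnitAddCircle) :=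
  ⟨by simp⟩

lemma isOpenQuotientMap_coe : IsOpenQuotientMap ((↑) : ℝ → UnitAddCircle) :=
  QuotientAddGroup.isOpenQuotientMap_mk

lemma continuous_of_lift {X : Type*} [TopologicalSpace X] {f : UnitAddCircle → X}
    (hf : Continuous fun x : ℝ => f (x : UnitAddCircle)) : Continuous f :=
  isOpenQuotientMap_coe.isQuotientMap.continuous_iff.2 hf

lemma continuous_of_lift_prod {X Y : Type*} [TopologicalSpace X] [TopologicalSpace Y]
    {f : Y × UnitAddCircle → X}
    (hf : Continuous fun z : Y × ℝ => f (z.1, (z.2 : UnitAddCircle))) : Continuous f :=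
  (IsOpenQuotientMap.id.prodMap isOpenQuotientMap_coe).isQuotientMap.continuous_iff.2 hf

lemma TorusSmooth.continuous {f : UnitAddCircle → ℝ} (hf : TorusSmooth f) : Continuous f :=
  continuous_of_lift (ContDiff.continuous hf)

lemma torusDeriv_coe (f : UnitAddCircle → ℝ) (x : ℝ) :
    torusDeriv f (x : UnitAddCircle) = deriv (fun y : ℝ => f (y : UnitAddCircle)) x := by
  have := deriv_comp_const_add (fun y : ℝ => f (y : UnitAddCircle)) x 0
  simpa [torusDeriv] using this

lemma TorusSmooth.torusDeriv {f : UnitAddCircle → ℝ} (hf : TorusSmooth f) :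
    TorusSmooth (torusDeriv f) := by
  have : (fun x : ℝ => BurgersMax.torusDeriv f (x : UnitAddCircle))
      = deriv (fun y : ℝ => f (y : UnitAddCircle)) := funext (torusDeriv_coe f)
  rw [TorusSmooth, this]
  exact (contDiff_infty_iff_deriv.1 hf).2

lemma TorusSmooth.hasDerivAt {f : UnitAddCircle → ℝ} (hf : TorusSmooth f) (x : ℝ) :
    HasDerivAt (fun y : ℝ => f (y : UnitAddCircle)) (BurgersMax.torusDeriv f x) x := by
  rw [torusDeriv_coe]
  exact ((ContDiff.differentiable hf (by simp)) x).hasDerivAt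

lemma TorusSmooth.mul {f g : UnitAddCircle → ℝ} (hf : TorusSmooth f) (hg : TorusSmooth g) :
    TorusSmooth (fun x => f x * g x) :=
  ContDiff.mul hf hg

lemma TorusSmooth.integrable {f : UnitAddCircle → ℝ} (hf : TorusSmooth f) : Integrable f :=
  hf.continuous.integrable_of_hasCompactSupport (HasCompactSupport.of_compactSpace f)

lemma TorusSmooth.exists_bound {f : UnitAddCircle → ℝ} (hf : TorusSmooth f) :
    ∃ C, 0 ≤ C ∧ ∀ x, |f x| ≤ C := by
  obtain ⟨C, hC⟩ := isCompact_univ.exists_bound_of_continuousOn hf.continuous.continuousOn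
  exact ⟨C, (abs_nonneg _).trans (hC 0 (mem_univ _)), fun x => hC x (mem_univ _)⟩

lemma TorusSmooth.torusDeriv_mul {f g : UnitAddCircle → ℝ} (hf : TorusSmooth f)
    (hg : TorusSmooth g) (x : UnitAddCircle) :
    BurgersMax.torusDeriv (fun y => f y * g y) x
      = BurgersMax.torusDeriv f x * g x + f x * BurgersMax.torusDeriv g x := by
  obtain ⟨x, rfl⟩ := isOpenQuotientMap_coe.surjective x
  rw [torusDeriv_coe]
  exact ((hf.hasDerivAt x).mul (hg.hasDerivAt x)).deriv

lemma TorusSmooth.integral_torusDeriv {f : UnitAddCircle → ℝ} (hf : TorusSmooth f) :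
    ∫ x, BurgersMax.torusDeriv f x = 0 := by
  rw [← UnitAddCircle.intervalIntegral_preimage 0]
  rw [intervalIntegral.integral_eq_sub_of_hasDerivAt (f := fun y : ℝ => f (y : UnitAddCircle))
    (fun x _ => hf.hasDerivAt x)]
  · simp [AddCircle.coe_period]
  · exact (ContDiff.continuous hf.torusDeriv).intervalIntegrable _ _

lemma TorusSmooth.integral_mul_torusDeriv {f g : UnitAddCircle → ℝ} (hf : TorusSmooth f)
    (hg : TorusSmooth g) :
    ∫ x, f x * BurgersMax.torusDeriv g x = -∫ x, BurgersMax.torusDeriv f x * g x := by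
  have h := (hf.mul hg).integral_torusDeriv
  simp_rw [hf.torusDeriv_mul hg] at h
  rw [integral_add (hf.torusDeriv.mul hg).integrable (hf.mul hg.torusDeriv).integrable] at h
  linarith

lemma TorusSmooth.comp_sub {f : UnitAddCircle → ℝ} (hf : TorusSmooth f) (x : UnitAddCircle) :
    TorusSmooth (fun y => f (x - y)) := by
  obtain ⟨x, rfl⟩ := isOpenQuotientMap_coe.surjective x
  exact ContDiff.comp (g := fun y : ℝ => f (y : UnitAddCircle)) hf
    (contDiff_const.sub contDiff_id : ContDiff ℝ ∞ fun y : ℝ => x - y)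

lemma torusDeriv_comp_sub (f : UnitAddCircle → ℝ) (x y : UnitAddCircle) :
    torusDeriv (fun y => f (x - y)) y = -torusDeriv f (x - y) := by
  obtain ⟨x, rfl⟩ := isOpenQuotientMap_coe.surjective x
  obtain ⟨y, rfl⟩ := isOpenQuotientMap_coe.surjective y
  rw [torusDeriv_coe, ← AddCircle.coe_sub, torusDeriv_coe]
  exact deriv_comp_const_sub (fun y : ℝ => f (y : UnitAddCircle)) x y

/-! ### Integration against signed measures -/

section SignedMeasure

variable {X : Type*} [MeasurableSpace X]

lemma integral_sub_toSignedMeasure {μ ν : Measure X} [IsFiniteMeasure μ] [IsFiniteMeasure ν]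
    {f : X → ℝ} (hμ : Integrable f μ) (hν : Integrable f ν) :
    ∫ᵛ x, f x ∂<•(μ.toSignedMeasure - ν.toSignedMeasure) = ∫ x, f x ∂μ - ∫ x, f x ∂ν := by
  rw [VectorMeasure.integral_sub_vectorMeasure, VectorMeasure.integral_toSignedMeasure,
    VectorMeasure.integral_toSignedMeasure]
  · simpa [VectorMeasure.Integrable] using hμ
  · simpa [VectorMeasure.Integrable] using hν

lemma integral_withDensityᵥ {μ : Measure X} {v f : X → ℝ} (hv : Integrable v μ)
    (hf : AEStronglyMeasurable f μ) {C : ℝ} (hC : ∀ x, |f x| ≤ C) :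
    ∫ᵛ x, f x ∂<•(μ.withDensityᵥ v) = ∫ x, f x * v x ∂μ := by
  have key : ∀ w : X → ℝ, Integrable w μ →
      Integrable f (μ.withDensity fun x => ENNReal.ofReal (w x)) ∧
      ∫ x, f x ∂(μ.withDensity fun x => ENNReal.ofReal (w x)) = ∫ x, f x * max (w x) 0 ∂μ := by
    intro w hw
    have := isFiniteMeasure_withDensity_ofReal hw.2
    refine ⟨Integrable.of_bound (hf.mono_ac (withDensity_absolutelyContinuous _ _)) C
      (Eventually.of_forall hC), ?_⟩
    rw [integral_withDensity_eq_integral_toReal_smul₀ hw.1.aemeasurable.ennreal_ofReal (by simp)]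
    refine integral_congr_ae (Eventually.of_forall fun x => ?_)
    simp [ENNReal.toReal_ofReal', mul_comm]
  have := isFiniteMeasure_withDensity_ofReal hv.2
  have := isFiniteMeasure_withDensity_ofReal hv.fun_neg.2
  rw [withDensityᵥ_eq_withDensity_pos_part_sub_withDensity_neg_part hv,
    integral_sub_toSignedMeasure (key v hv).1 (key _ hv.fun_neg).1, (key v hv).2, (key _ hv.fun_neg).2,
    ← integral_sub]
  · refine integral_congr_ae (Eventually.of_forall fun x => ?_)
    simp only
    rw [← mul_sub]
    congr 1
    rcases le_total 0 (v x) with h | h <;> simp [h]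
  · exact hv.pos_part.bdd_mul hf (Eventually.of_forall hC)
  · exact hv.fun_neg.pos_part.bdd_mul hf (Eventually.of_forall hC)

/-- The pair `(μ, v)` in the definition of `measureAction` is unique, so that the infimum is the
value at any admissible pair. -/
lemma measureAction_eq {r q : SignedMeasure X} {μ : Measure X} [IsFiniteMeasure μ] {v : X → ℝ}
    (hr : μ.toSignedMeasure = r) (hv : Integrable v μ) (hq : q = μ.withDensityᵥ v) :
    measureAction r q = ∫⁻ z, ENNReal.ofReal (v z ^ 2 / 2) ∂μ := by
  apply le_antisymm
  · exact iInf_le_of_le μ (iInf_le_of_le inferInstance (iInf_le_of_le v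
      (iInf_le_of_le ⟨hr, hv, hq⟩ le_rfl)))
  · refine le_iInf fun μ' => le_iInf fun hfin => le_iInf fun v' => le_iInf fun h => ?_
    obtain ⟨hr', hv', hq'⟩ := h
    obtain rfl : μ = μ' := Measure.toSignedMeasure_eq_toSignedMeasure_iff.1 (hr.trans hr'.symm)
    have := (hv.withDensityᵥ_eq_iff hv').1 (hq.symm.trans hq')
    refine (lintegral_congr_ae ?_).le
    filter_upwards [this] with z hz
    rw [hz]

end SignedMeasure

/-! ### The slab `(0,T) × 𝕋` -/

lemma slab_eq_restrict (T : ℝ) :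
    slab T = (volume : Measure (ℝ × UnitAddCircle)).restrict (Ioo 0 T ×ˢ univ) := by
  rw [slab, Measure.volume_eq_prod, ← Measure.prod_restrict, Measure.restrict_univ]

lemma measurableSet_Ioo_prod (T : ℝ) :
    MeasurableSet (Ioo 0 T ×ˢ (univ : Set UnitAddCircle)) :=
  measurableSet_Ioo.prod MeasurableSet.univ

lemma ae_slab_mem (T : ℝ) : ∀ᵐ z ∂(slab T), z.1 ∈ Ioo 0 T := by
  rw [slab_eq_restrict]
  filter_upwards [ae_restrict_mem (measurableSet_Ioo_prod T)] with z hz using hz.1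

lemma isCompact_Icc_prod (T : ℝ) : IsCompact (Icc 0 T ×ˢ (univ : Set UnitAddCircle)) :=
  isCompact_Icc.prod isCompact_univ

lemma integrable_slab_of_continuousOn {T : ℝ} {f : ℝ × UnitAddCircle → ℝ}
    (hf : ContinuousOn f (Icc 0 T ×ˢ univ)) : Integrable f (slab T) := by
  rw [slab_eq_restrict]
  exact (hf.integrableOn_compact (isCompact_Icc_prod T)).mono_set
    (prod_mono Ioo_subset_Icc_self subset_rfl)

lemma exists_bound_of_continuousOn {T : ℝ} {f : ℝ × UnitAddCircle → ℝ}
    (hf : ContinuousOn f (Icc 0 T ×ˢ univ)) :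
    ∃ C, 0 ≤ C ∧ ∀ t ∈ Icc 0 T, ∀ x, |f (t, x)| ≤ C := by
  obtain ⟨C, hC⟩ := (isCompact_Icc_prod T).exists_bound_of_continuousOn hf
  exact ⟨max C 0, le_max_right _ _, fun t ht x =>
    (hC (t, x) ⟨ht, mem_univ _⟩).trans (le_max_left _ _)⟩

lemma continuousOn_of_lift {T : ℝ} (hT : 0 < T) {f : ℝ × UnitAddCircle → ℝ}
    (hf : ContinuousOn (fun z : ℝ × ℝ => f (z.1, (z.2 : UnitAddCircle))) (Icc 0 T ×ˢ univ)) :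
    ContinuousOn f (Icc 0 T ×ˢ univ) := by
  have h1 : Continuous fun z : Icc 0 T × UnitAddCircle => f (z.1, z.2) := by
    apply continuous_of_lift_prod (f := fun z : Icc 0 T × UnitAddCircle => f (z.1, z.2))
    exact hf.comp_continuous (f := fun z : Icc 0 T × ℝ => ((z.1 : ℝ), z.2)) (by fun_prop)
      fun z => ⟨z.1.2, mem_univ _⟩
  have h2 : Continuous fun z : ℝ × UnitAddCircle => f (projIcc 0 T hT.le z.1, z.2) :=
    h1.comp (by fun_prop : Continuous fun z : ℝ × UnitAddCircle => (projIcc 0 T hT.le z.1, z.2))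
  refine h2.continuousOn.congr fun z hz => ?_
  simp [projIcc_of_mem hT.le hz.1]

/-! ### Smooth functions on `ℝ × 𝕋` -/

section Smooth

variable {φ : ℝ × UnitAddCircle → ℝ}

lemma continuous_of_contDiff_lift
    (hφ : ContDiff ℝ ∞ fun z : ℝ × ℝ => φ (z.1, (z.2 : UnitAddCircle))) : Continuous φ :=
  continuous_of_lift_prod hφ.continuous

lemma hasDerivAt_time (hφ : ContDiff ℝ ∞ fun z : ℝ × ℝ => φ (z.1, (z.2 : UnitAddCircle)))
    (t x : ℝ) :
    HasDerivAt (fun s => φ (s, (x : UnitAddCircle)))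
      (fderiv ℝ (fun z : ℝ × ℝ => φ (z.1, (z.2 : UnitAddCircle))) (t, x) (1, 0)) t :=
  ((hφ.differentiable (by simp)) (t, x)).hasFDerivAt.comp_hasDerivAt (f := fun s => (s, x)) t
    ((hasDerivAt_id t).prodMk (hasDerivAt_const t x))

lemma hasDerivAt_space (hφ : ContDiff ℝ ∞ fun z : ℝ × ℝ => φ (z.1, (z.2 : UnitAddCircle)))
    (t x : ℝ) :
    HasDerivAt (fun y : ℝ => φ (t, (y : UnitAddCircle)))
      (fderiv ℝ (fun z : ℝ × ℝ => φ (z.1, (z.2 : UnitAddCircle))) (t, x) (0, 1)) x :=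
  ((hφ.differentiable (by simp)) (t, x)).hasFDerivAt.comp_hasDerivAt (f := fun y => (t, y)) x
    ((hasDerivAt_const x t).prodMk (hasDerivAt_id x))

lemma continuous_time_deriv
    (hφ : ContDiff ℝ ∞ fun z : ℝ × ℝ => φ (z.1, (z.2 : UnitAddCircle))) :
    Continuous fun z : ℝ × UnitAddCircle => deriv (fun s => φ (s, z.2)) z.1 := by
  apply continuous_of_lift_prod
  have h := (hφ.continuous_fderiv (by simp)).clm_apply (continuous_const (y := ((1 : ℝ), (0 : ℝ))))
  exact h.congr fun z => ((hasDerivAt_time hφ z.1 z.2).deriv).symm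

lemma continuous_torusDeriv
    (hφ : ContDiff ℝ ∞ fun z : ℝ × ℝ => φ (z.1, (z.2 : UnitAddCircle))) :
    Continuous fun z : ℝ × UnitAddCircle => torusDeriv (fun y => φ (z.1, y)) z.2 := by
  apply continuous_of_lift_prod
  have h := (hφ.continuous_fderiv (by simp)).clm_apply (continuous_const (y := ((0 : ℝ), (1 : ℝ))))
  refine h.congr fun z => ?_
  rw [torusDeriv_coe]
  exact ((hasDerivAt_space hφ z.1 z.2).deriv).symm

lemma torusSmooth_slice
    (hφ : ContDiff ℝ ∞ fun z : ℝ × ℝ => φ (z.1, (z.2 : UnitAddCircle))) (t : ℝ) :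
    TorusSmooth fun x => φ (t, x) :=
  hφ.comp (contDiff_const.prodMk contDiff_id : ContDiff ℝ ∞ fun x : ℝ => (t, x))

lemma IsTestFunction.eq_zero {T : ℝ} (hφ : IsTestFunction T φ) {t : ℝ} (ht : t ∉ Ioo 0 T)
    (x : UnitAddCircle) : φ (t, x) = 0 :=
  image_eq_zero_of_notMem_tsupport fun h => ht (hφ.support h).1

end Smooth

/-! ### Smooth competitors -/

namespace SmoothCompetitor

variable {T : ℝ} {W : ℝ → UnitAddCircle → ℝ}

lemma continuousOn (hT : 0 < T) (hW : SmoothCompetitor T W) :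
    ContinuousOn (fun z : ℝ × UnitAddCircle => W z.1 z.2) (Icc 0 T ×ˢ univ) :=
  continuousOn_of_lift hT hW.smooth.continuousOn

lemma uniqueDiffOn (hT : 0 < T) : UniqueDiffOn ℝ (Icc 0 T ×ˢ (univ : Set ℝ)) :=
  (uniqueDiffOn_Icc hT).prod uniqueDiffOn_univ

lemma torusSmooth (hW : SmoothCompetitor T W) {t : ℝ} (ht : t ∈ Icc 0 T) : TorusSmooth (W t) := by
  have := hW.smooth.comp (s := univ)
    (contDiff_const.prodMk contDiff_id : ContDiff ℝ ∞ fun x : ℝ => (t, x)).contDiffOn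
    (fun x _ => ⟨ht, mem_univ _⟩)
  exact contDiffOn_univ.1 this

lemma hasDerivWithinAt_fderivWithin (hW : SmoothCompetitor T W) {t : ℝ} (ht : t ∈ Icc 0 T)
    (x : ℝ) :
    HasDerivWithinAt (fun s => W s (x : UnitAddCircle))
      (fderivWithin ℝ (fun z : ℝ × ℝ => W z.1 (z.2 : UnitAddCircle)) (Icc 0 T ×ˢ univ) (t, x)
        (1, 0)) (Icc 0 T) t :=
  ((hW.smooth.differentiableOn (by simp)) (t, x) ⟨ht, mem_univ _⟩).hasFDerivWithinAt.comp_hasDerivWithinAt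
    (f := fun s : ℝ => (s, x)) t
    ((hasDerivWithinAt_id t _).prodMk (hasDerivWithinAt_const t _ x))
    (fun s hs => ⟨hs, mem_univ _⟩)

lemma hasDerivWithinAt (hT : 0 < T) (hW : SmoothCompetitor T W) {t : ℝ} (ht : t ∈ Icc 0 T)
    (x : UnitAddCircle) :
    HasDerivWithinAt (fun s => W s x) (derivWithin (fun s => W s x) (Icc 0 T) t) (Icc 0 T) t := by
  obtain ⟨x, rfl⟩ := isOpenQuotientMap_coe.surjective x
  have h := hW.hasDerivWithinAt_fderivWithin ht x
  rwa [h.derivWithin (uniqueDiffOn_Icc hT t ht)]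

lemma continuousOn_timeDeriv (hT : 0 < T) (hW : SmoothCompetitor T W) :
    ContinuousOn (fun z : ℝ × UnitAddCircle => derivWithin (fun s => W s z.2) (Icc 0 T) z.1)
      (Icc 0 T ×ˢ univ) := by
  apply continuousOn_of_lift hT
  refine ContinuousOn.congr ((hW.smooth.continuousOn_fderivWithin (uniqueDiffOn hT)
    (by simp)).clm_apply (continuousOn_const (c := ((1 : ℝ), (0 : ℝ))))) fun z hz => ?_
  exact (hW.hasDerivWithinAt_fderivWithin hz.1 z.2).derivWithin (uniqueDiffOn_Icc hT z.1 hz.1)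

lemma continuousOn_spaceDeriv (hT : 0 < T) (hW : SmoothCompetitor T W) :
    ContinuousOn (fun z : ℝ × UnitAddCircle => torusDeriv (W z.1) z.2) (Icc 0 T ×ˢ univ) := by
  apply continuousOn_of_lift hT
  refine ContinuousOn.congr ((hW.smooth.continuousOn_fderivWithin (uniqueDiffOn hT)
    (by simp)).clm_apply (continuousOn_const (c := ((0 : ℝ), (1 : ℝ))))) fun z hz => ?_
  rw [torusDeriv_coe]
  have h := ((hW.smooth.differentiableOn (by simp)) z hz).hasFDerivWithinAt.comp_hasDerivWithinAt
    (f := fun y : ℝ => (z.1, y)) (s := univ) z.2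
    ((hasDerivWithinAt_const z.2 _ z.1).prodMk (hasDerivWithinAt_id z.2 _))
    (fun s _ => ⟨hz.1, mem_univ _⟩)
  exact (hasDerivWithinAt_univ.1 h).deriv

lemma integral_timeDeriv_mul (hT : 0 < T) (hW : SmoothCompetitor T W)
    {φ : ℝ × UnitAddCircle → ℝ} (hφ : IsTestFunction T φ) :
    ∫ z, φ z * derivWithin (fun s => W s z.2) (Icc 0 T) z.1 ∂(slab T)
      = -∫ z, W z.1 z.2 * deriv (fun s => φ (s, z.2)) z.1 ∂(slab T) := by
  have hc1 : ContinuousOn (fun z : ℝ × UnitAddCircle =>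
      φ z * derivWithin (fun s => W s z.2) (Icc 0 T) z.1) (Icc 0 T ×ˢ univ) :=
    (continuous_of_contDiff_lift hφ.smooth).continuousOn.mul (hW.continuousOn_timeDeriv hT)
  have hc2 : ContinuousOn (fun z : ℝ × UnitAddCircle =>
      W z.1 z.2 * deriv (fun s => φ (s, z.2)) z.1) (Icc 0 T ×ˢ univ) :=
    (hW.continuousOn hT).mul (continuous_time_deriv hφ.smooth).continuousOn
  rw [eq_neg_iff_add_eq_zero, ← integral_add (integrable_slab_of_continuousOn hc1)
    (integrable_slab_of_continuousOn hc2)]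
  refine (integral_prod_symm _ (integrable_slab_of_continuousOn (hc1.add hc2))).trans ?_
  refine integral_eq_zero_of_ae (Eventually.of_forall fun x => ?_)
  have hmap : ContinuousOn (fun t : ℝ => (t, x)) (Icc 0 T) := by fun_prop
  have hsub : MapsTo (fun t : ℝ => (t, x)) (Icc 0 T) (Icc 0 T ×ˢ univ) :=
    fun t ht => ⟨ht, mem_univ _⟩
  simp only [Pi.zero_apply]
  rw [← integral_Ioc_eq_integral_Ioo, ← intervalIntegral.integral_of_le hT.le,
    intervalIntegral.integral_eq_sub_of_hasDerivAt_of_le hT.le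
      (f := fun t => φ (t, x) * W t x)]
  · simp [hφ.eq_zero (t := 0) (by simp), hφ.eq_zero (t := T) (by simp)]
  · exact ((continuous_of_contDiff_lift hφ.smooth).continuousOn.mul
      (hW.continuousOn hT)).comp hmap hsub
  · intro t ht
    have h1 : HasDerivAt (fun s => φ (s, x)) (deriv (fun s => φ (s, x)) t) t := by
      obtain ⟨x, rfl⟩ := isOpenQuotientMap_coe.surjective x
      exact (hasDerivAt_time hφ.smooth t x).differentiableAt.hasDerivAt
    have h2 := (hW.hasDerivWithinAt hT (Ioo_subset_Icc_self ht) x).hasDerivAt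
      (Icc_mem_nhds ht.1 ht.2)
    refine (h1.mul h2).congr_deriv ?_
    simp only [Pi.add_apply]
    ring
  · exact ((hc1.add hc2).comp hmap hsub).intervalIntegrable_of_Icc hT.le

lemma integral_spaceDeriv_mul (hT : 0 < T) (hW : SmoothCompetitor T W)
    {φ : ℝ × UnitAddCircle → ℝ} (hφ : IsTestFunction T φ) :
    ∫ z, φ z * torusDeriv (W z.1) z.2 ∂(slab T)
      = -∫ z, W z.1 z.2 * torusDeriv (fun y => φ (z.1, y)) z.2 ∂(slab T) := by
  have hc1 : ContinuousOn (fun z : ℝ × UnitAddCircle =>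
      φ z * torusDeriv (W z.1) z.2) (Icc 0 T ×ˢ univ) :=
    (continuous_of_contDiff_lift hφ.smooth).continuousOn.mul (hW.continuousOn_spaceDeriv hT)
  have hc2 : ContinuousOn (fun z : ℝ × UnitAddCircle =>
      W z.1 z.2 * torusDeriv (fun y => φ (z.1, y)) z.2) (Icc 0 T ×ˢ univ) :=
    (hW.continuousOn hT).mul (continuous_torusDeriv hφ.smooth).continuousOn
  rw [integral_prod _ (integrable_slab_of_continuousOn hc1),
    integral_prod _ (integrable_slab_of_continuousOn hc2), ← integral_neg]
  refine setIntegral_congr_fun measurableSet_Ioo fun t ht => ?_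
  have h := (torusSmooth_slice hφ.smooth t).integral_mul_torusDeriv
    (hW.torusSmooth (Ioo_subset_Icc_self ht))
  simp only [h, mul_comm (W t _)]

end SmoothCompetitor

/-! ### Smooth competitors as generalized competitors -/

/-- The mass measure `ρ = (1 - ∂ₓW) dt dx` of a smooth competitor. -/
noncomputable def massMeasure (T : ℝ) (W : ℝ → UnitAddCircle → ℝ) : Measure (ℝ × UnitAddCircle) :=
  (slab T).withDensity fun z => ENNReal.ofReal (1 - torusDeriv (W z.1) z.2)

/-- The velocity `v = ∂ₜW / (1 - ∂ₓW)` of a smooth competitor, equal to `0` where `∂ₓW = 1`. -/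
noncomputable def velocity (T : ℝ) (W : ℝ → UnitAddCircle → ℝ) (z : ℝ × UnitAddCircle) : ℝ :=
  derivWithin (fun s => W s z.2) (Icc 0 T) z.1 / (1 - torusDeriv (W z.1) z.2)

namespace SmoothCompetitor

variable {T : ℝ} {W : ℝ → UnitAddCircle → ℝ}

lemma integrable_timeDeriv (hT : 0 < T) (hW : SmoothCompetitor T W) :
    Integrable (fun z : ℝ × UnitAddCircle => derivWithin (fun s => W s z.2) (Icc 0 T) z.1)
      (slab T) :=
  integrable_slab_of_continuousOn (hW.continuousOn_timeDeriv hT)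

lemma integrable_spaceDeriv (hT : 0 < T) (hW : SmoothCompetitor T W) :
    Integrable (fun z : ℝ × UnitAddCircle => torusDeriv (W z.1) z.2) (slab T) :=
  integrable_slab_of_continuousOn (hW.continuousOn_spaceDeriv hT)

lemma integrable_density (hT : 0 < T) (hW : SmoothCompetitor T W) :
    Integrable (fun z : ℝ × UnitAddCircle => 1 - torusDeriv (W z.1) z.2) (slab T) :=
  (integrable_const _).sub (hW.integrable_spaceDeriv hT)

lemma ae_density_nonneg (hW : SmoothCompetitor T W) :
    ∀ᵐ z ∂(slab T), 0 ≤ 1 - torusDeriv (W z.1) z.2 := by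
  filter_upwards [ae_slab_mem T] with z hz
  linarith [hW.deriv_le z.1 (Ioo_subset_Icc_self hz) z.2]

lemma ae_density_mul_velocity (hW : SmoothCompetitor T W) :
    ∀ᵐ z ∂(slab T), (1 - torusDeriv (W z.1) z.2) * velocity T W z
      = derivWithin (fun s => W s z.2) (Icc 0 T) z.1 := by
  filter_upwards [ae_slab_mem T] with z hz
  by_cases h : torusDeriv (W z.1) z.2 = 1
  · simp [h, hW.deriv_eq z.1 (Ioo_subset_Icc_self hz) z.2 h]
  · rw [velocity, mul_div_cancel₀]
    exact sub_ne_zero.2 (Ne.symm h)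

lemma isFiniteMeasure_massMeasure (hT : 0 < T) (hW : SmoothCompetitor T W) :
    IsFiniteMeasure (massMeasure T W) :=
  isFiniteMeasure_withDensity_ofReal (hW.integrable_density hT).2

lemma integral_massMeasure (hT : 0 < T) (hW : SmoothCompetitor T W) (f : ℝ × UnitAddCircle → ℝ) :
    ∫ z, f z ∂(massMeasure T W) = ∫ z, f z * (1 - torusDeriv (W z.1) z.2) ∂(slab T) := by
  rw [massMeasure, integral_withDensity_eq_integral_toReal_smul₀
    (hW.integrable_density hT).1.aemeasurable.ennreal_ofReal (by simp)]
  refine integral_congr_ae ?_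
  filter_upwards [hW.ae_density_nonneg] with z hz
  rw [ENNReal.toReal_ofReal hz, smul_eq_mul, mul_comm]

lemma integral_massMeasure_velocity (hT : 0 < T) (hW : SmoothCompetitor T W)
    (f : ℝ × UnitAddCircle → ℝ) :
    ∫ z, f z * velocity T W z ∂(massMeasure T W)
      = ∫ z, f z * derivWithin (fun s => W s z.2) (Icc 0 T) z.1 ∂(slab T) := by
  rw [hW.integral_massMeasure hT]
  refine integral_congr_ae ?_
  filter_upwards [hW.ae_density_mul_velocity] with z hz
  rw [← hz]
  ring

lemma aestronglyMeasurable_velocity (hT : 0 < T) (hW : SmoothCompetitor T W) :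
    AEStronglyMeasurable (velocity T W) (slab T) :=
  ((hW.integrable_timeDeriv hT).1.aemeasurable.div
    (hW.integrable_density hT).1.aemeasurable).aestronglyMeasurable

lemma integrable_velocity (hT : 0 < T) (hW : SmoothCompetitor T W) :
    Integrable (velocity T W) (massMeasure T W) := by
  rw [massMeasure, integrable_withDensity_iff_integrable_smul₀'
    (hW.integrable_density hT).1.aemeasurable.ennreal_ofReal (by simp)]
  refine (hW.integrable_timeDeriv hT).congr ?_
  filter_upwards [hW.ae_density_mul_velocity, hW.ae_density_nonneg] with z hz hz'
  rw [ENNReal.toReal_ofReal hz', smul_eq_mul, hz]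

lemma lintegral_velocity (hT : 0 < T) (hW : SmoothCompetitor T W) :
    ∫⁻ z, ENNReal.ofReal (velocity T W z ^ 2 / 2) ∂(massMeasure T W) = smoothAction T W := by
  rw [massMeasure, lintegral_withDensity_eq_lintegral_mul₀
    (hW.integrable_density hT).1.aemeasurable.ennreal_ofReal
    (((hW.aestronglyMeasurable_velocity hT).aemeasurable.pow_const 2).div_const 2).ennreal_ofReal]
  refine lintegral_congr_ae ?_
  filter_upwards [hW.ae_density_nonneg] with z hz
  rw [Pi.mul_apply, ← ENNReal.ofReal_mul hz, velocity]
  congr 1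
  by_cases h : 1 - torusDeriv (W z.1) z.2 = 0
  · simp [h]
  · field_simp

lemma massMeasure_toSignedMeasure (hT : 0 < T) (hW : SmoothCompetitor T W) :
    haveI := hW.isFiniteMeasure_massMeasure hT
    (massMeasure T W).toSignedMeasure = (slab T).toSignedMeasure
      - (slab T).withDensityᵥ fun z => torusDeriv (W z.1) z.2 := by
  have := hW.isFiniteMeasure_massMeasure hT
  ext s hs
  rw [Measure.toSignedMeasure_apply_measurable hs, _root_.sub_apply,
    Measure.toSignedMeasure_apply_measurable hs, withDensityᵥ_apply (hW.integrable_spaceDeriv hT) hs]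
  have h1 : (slab T).real s = ∫ z in s, (1 : ℝ) ∂(slab T) := by simp
  rw [h1, ← integral_sub (integrable_const _) (hW.integrable_spaceDeriv hT).integrableOn, measureReal_def,
    massMeasure, withDensity_apply _ hs, integral_eq_lintegral_of_nonneg_ae
      (ae_restrict_of_ae hW.ae_density_nonneg) (hW.integrable_density hT).integrableOn.1]

lemma withDensityᵥ_timeDeriv (hT : 0 < T) (hW : SmoothCompetitor T W) :
    ((slab T).withDensityᵥ fun z => derivWithin (fun s => W s z.2) (Icc 0 T) z.1)
      = (massMeasure T W).withDensityᵥ (velocity T W) := by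
  ext s hs
  rw [withDensityᵥ_apply (hW.integrable_timeDeriv hT) hs,
    withDensityᵥ_apply (hW.integrable_velocity hT) hs, ← integral_indicator hs,
    ← integral_indicator hs]
  have e : ∀ g : ℝ × UnitAddCircle → ℝ, s.indicator g = fun z => s.indicator 1 z * g z := by
    intro g
    funext z
    by_cases hz : z ∈ s <;> simp [hz]
  rw [e, e (velocity T W)]
  exact (hW.integral_massMeasure_velocity hT (s.indicator 1)).symm

lemma withDensityᵥ_restrict {f : ℝ × UnitAddCircle → ℝ} (hf : Integrable f (slab T)) :
    ((slab T).withDensityᵥ f).restrict (Ioo 0 T ×ˢ univ) = (slab T).withDensityᵥ f := by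
  ext s hs
  rw [VectorMeasure.restrict_apply _ (measurableSet_Ioo_prod T) hs,
    withDensityᵥ_apply hf (hs.inter (measurableSet_Ioo_prod T)), withDensityᵥ_apply hf hs,
    slab_eq_restrict, Measure.restrict_restrict (hs.inter (measurableSet_Ioo_prod T)),
    Measure.restrict_restrict hs, inter_assoc, inter_self]

/-- A smooth competitor is a generalized competitor, its derivatives being the measures with
densities `∂ₜW` and `∂ₓW`. -/
lemma bvCompetitor (hT : 0 < T) (hW : SmoothCompetitor T W) :
    BVCompetitor T W
      ((slab T).withDensityᵥ fun z => derivWithin (fun s => W s z.2) (Icc 0 T) z.1)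
      ((slab T).withDensityᵥ fun z => torusDeriv (W z.1) z.2) := by
  have htest : ∀ φ, IsTestFunction T φ → ∃ C, ∀ z, |φ z| ≤ C := fun φ hφ =>
    (continuous_of_contDiff_lift hφ.smooth).bounded_above_of_compact_support hφ.compact
  refine ⟨integrable_slab_of_continuousOn (hW.continuousOn hT),
    fun t ht => (hW.torusSmooth ht).integrable, ⟨withDensityᵥ_restrict (hW.integrable_timeDeriv hT),
      fun φ hφ => ?_⟩, ⟨withDensityᵥ_restrict (hW.integrable_spaceDeriv hT), fun φ hφ => ?_⟩, ?_, ?_,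
    Eventually.of_forall hW.final⟩
  · obtain ⟨C, hC⟩ := htest φ hφ
    rw [integral_withDensityᵥ (hW.integrable_timeDeriv hT)
      (continuous_of_contDiff_lift hφ.smooth).aestronglyMeasurable hC]
    exact hW.integral_timeDeriv_mul hT hφ
  · obtain ⟨C, hC⟩ := htest φ hφ
    rw [integral_withDensityᵥ (hW.integrable_spaceDeriv hT)
      (continuous_of_contDiff_lift hφ.smooth).aestronglyMeasurable hC]
    exact hW.integral_spaceDeriv_mul hT hφ
  · intro ψ hψ
    refine isCompact_Icc.uniformContinuousOn_of_continuous ?_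
    have hc : ContinuousOn (fun z : ℝ × UnitAddCircle => W z.1 z.2 * ψ z.2) (Icc 0 T ×ˢ univ) :=
      (hW.continuousOn hT).mul (hψ.continuous.comp continuous_snd).continuousOn
    obtain ⟨C, -, hC⟩ := exists_bound_of_continuousOn hc
    refine continuousOn_of_dominated (bound := fun _ => C) (fun t ht => ?_) (fun t ht => ?_)
      (integrable_const _) (Eventually.of_forall fun x => ?_)
    · exact ((hW.torusSmooth ht).mul hψ).continuous.aestronglyMeasurable
    · exact Eventually.of_forall fun x => hC t ht x
    · exact hc.comp (f := fun t : ℝ => (t, x)) (by fun_prop) fun t ht => ⟨ht, mem_univ _⟩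
  · have := hW.isFiniteMeasure_massMeasure hT
    have h := hW.massMeasure_toSignedMeasure hT
    rw [← sub_nonneg, ← h]
    exact Measure.zero_le_toSignedMeasure _

lemma measureAction_eq (hT : 0 < T) (hW : SmoothCompetitor T W) :
    measureAction ((slab T).toSignedMeasure - (slab T).withDensityᵥ fun z => torusDeriv (W z.1) z.2)
      ((slab T).withDensityᵥ fun z => derivWithin (fun s => W s z.2) (Icc 0 T) z.1)
      = smoothAction T W := by
  have := hW.isFiniteMeasure_massMeasure hT
  rw [BurgersMax.measureAction_eq (hW.massMeasure_toSignedMeasure hT) (hW.integrable_velocity hT)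
    (hW.withDensityᵥ_timeDeriv hT), hW.lintegral_velocity hT]

end SmoothCompetitor

/-! ### Cutoffs in time -/

/-- A smooth step, equal to `0` on `(-∞, 1]` and to `1` on `[2, ∞)`. -/
noncomputable def step (x : ℝ) : ℝ := Real.smoothTransition (x - 1)

lemma contDiff_step : ContDiff ℝ ∞ step :=
  Real.smoothTransition.contDiff.comp (contDiff_id.sub contDiff_const)

lemma step_eq_zero {x : ℝ} (hx : x ≤ 1) : step x = 0 :=
  Real.smoothTransition.zero_of_nonpos (by linarith)

lemma step_eq_one {x : ℝ} (hx : 2 ≤ x) : step x = 1 :=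
  Real.smoothTransition.one_of_one_le (by linarith)

lemma step_nonneg (x : ℝ) : 0 ≤ step x := Real.smoothTransition.nonneg _

lemma step_le_one (x : ℝ) : step x ≤ 1 := Real.smoothTransition.le_one _

lemma hasDerivAt_step (x : ℝ) : HasDerivAt step (deriv step x) x :=
  ((contDiff_step.differentiable (by simp)) x).hasDerivAt

lemma continuous_deriv_step : Continuous (deriv step) :=
  contDiff_step.continuous_deriv (by simp)

lemma deriv_step_eq_zero {x : ℝ} (hx : x ∉ Ioo (1 : ℝ) 2) : deriv step x = 0 := by
  have h : ∀ y, y < 1 ∨ 2 < y → deriv step y = 0 := by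
    rintro y (hy | hy)
    · rw [(eventuallyEq_of_mem (Iio_mem_nhds hy) fun z hz => step_eq_zero (le_of_lt hz) :
        step =ᶠ[𝓝 y] fun _ => 0).deriv_eq, deriv_const]
    · rw [(eventuallyEq_of_mem (Ioi_mem_nhds hy) fun z hz => step_eq_one (le_of_lt hz) :
        step =ᶠ[𝓝 y] fun _ => 1).deriv_eq, deriv_const]
  have hcl : IsClosed {y | deriv step y = 0} := isClosed_eq continuous_deriv_step continuous_const
  rcases le_or_gt x 1 with h1 | h1
  · have : Iic (1 : ℝ) ⊆ {y | deriv step y = 0} := by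
      rw [← closure_Iio]
      exact hcl.closure_subset_iff.2 fun y hy => h y (Or.inl hy)
    exact this h1
  · have : Ici (2 : ℝ) ⊆ {y | deriv step y = 0} := by
      rw [← closure_Ioi]
      exact hcl.closure_subset_iff.2 fun y hy => h y (Or.inr hy)
    exact this (not_lt.1 fun h2 => hx ⟨h1, h2⟩)

lemma hasCompactSupport_deriv_step : HasCompactSupport (deriv step) :=
  HasCompactSupport.intro (isCompact_Icc (a := (1 : ℝ)) (b := 2)) fun _ hx =>
    deriv_step_eq_zero fun h => hx (Ioo_subset_Icc_self h)

lemma integral_deriv_step : ∫ x, deriv step x = 1 := by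
  have h : ∫ x in (1 : ℝ)..2, deriv step x = 1 := by
    rw [intervalIntegral.integral_eq_sub_of_hasDerivAt (fun x _ => hasDerivAt_step x)
      (continuous_deriv_step.intervalIntegrable _ _), step_eq_one le_rfl, step_eq_zero le_rfl,
      sub_zero]
  rw [← h, intervalIntegral.integral_of_le (by norm_num), integral_Ioc_eq_integral_Ioo,
    setIntegral_eq_integral_of_forall_compl_eq_zero fun x hx => deriv_step_eq_zero hx]

/-- The derivatives `k step'(k t)` concentrate at `0`. -/
lemma tendsto_integral_deriv_step {h : ℝ → ℝ} (hh : Continuous h) {C : ℝ} (hC : ∀ t, |h t| ≤ C) :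
    Tendsto (fun k : ℕ => ∫ t, (k * deriv step (k * t)) * h t) atTop (𝓝 (h 0)) := by
  have h1 : Tendsto (fun k : ℕ => ∫ s, deriv step s * h (s / k)) atTop
      (𝓝 (∫ s, deriv step s * h 0)) := by
    refine tendsto_integral_of_dominated_convergence (fun s => ‖deriv step s‖ * C) (fun k => ?_)
      ?_ (fun k => Eventually.of_forall fun s => ?_) (Eventually.of_forall fun s => ?_)
    · exact (continuous_deriv_step.mul (by fun_prop)).aestronglyMeasurable
    · exact (continuous_deriv_step.integrable_of_hasCompactSupport
        hasCompactSupport_deriv_step).norm.mul_const C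
    · rw [norm_mul]
      exact mul_le_mul_of_nonneg_left (hC _) (norm_nonneg _)
    · have : Tendsto (fun k : ℕ => s / (k : ℝ)) atTop (𝓝 0) :=
        tendsto_const_nhds.div_atTop tendsto_natCast_atTop_atTop
      exact ((hh.tendsto 0).comp this).const_mul _
  rw [integral_mul_const, integral_deriv_step, one_mul] at h1
  refine h1.congr' ?_
  filter_upwards [eventually_gt_atTop 0] with k hk
  have hk' : (0 : ℝ) < k := by exact_mod_cast hk
  have := Measure.integral_comp_mul_left (fun s => deriv step s * h (s / k)) (k : ℝ)
  rw [abs_of_pos (inv_pos.2 hk'), smul_eq_mul, eq_inv_mul_iff_mul_eq₀ hk'.ne',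
    ← integral_const_mul] at this
  rw [← this]
  refine integral_congr_ae (Eventually.of_forall fun t => ?_)
  simp only
  rw [mul_div_cancel_left₀ _ hk'.ne', mul_assoc]

/-- Cutoffs in time, compactly supported in `(0, T)` and equal to `1` on `[2/k, T - 2/k]`. -/
noncomputable def cutoff (T : ℝ) (k : ℕ) (t : ℝ) : ℝ := step (k * t) + step (k * (T - t)) - 1

lemma contDiff_cutoff (T : ℝ) (k : ℕ) : ContDiff ℝ ∞ (cutoff T k) :=
  ((contDiff_step.comp (contDiff_const.mul contDiff_id)).add
    (contDiff_step.comp (contDiff_const.mul (contDiff_const.sub contDiff_id)))).sub contDiff_const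

lemma deriv_cutoff (T : ℝ) (k : ℕ) (t : ℝ) :
    deriv (cutoff T k) t = k * deriv step (k * t) - k * deriv step (k * (T - t)) := by
  have h1 : HasDerivAt (fun t : ℝ => step (k * t)) (deriv step (k * t) * (k * 1)) t :=
    (hasDerivAt_step _).comp t ((hasDerivAt_id t).const_mul (k : ℝ))
  have h2 : HasDerivAt (fun t : ℝ => step (k * (T - t))) (deriv step (k * (T - t)) * (k * (-1))) t :=
    (hasDerivAt_step _).comp t (((hasDerivAt_id t).const_sub T).const_mul (k : ℝ))
  have h3 : HasDerivAt (cutoff T k) _ t := (h1.add h2).sub_const 1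
  rw [h3.deriv]
  ring

lemma abs_cutoff_le {T : ℝ} {k : ℕ} (t : ℝ) : |cutoff T k t| ≤ 1 := by
  have h1 := step_nonneg (k * t)
  have h2 := step_nonneg (k * (T - t))
  have h3 := step_le_one (k * t)
  have h4 := step_le_one (k * (T - t))
  rw [cutoff, abs_le]
  constructor <;> linarith

lemma cutoff_eq_zero {T : ℝ} {k : ℕ} (hk : 4 ≤ k * T) {t : ℝ} (ht : k * t ≤ 1 ∨ k * (T - t) ≤ 1) :
    cutoff T k t = 0 := by
  rcases ht with ht | ht
  · rw [cutoff, step_eq_zero ht, step_eq_one (by linarith)]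
    ring
  · rw [cutoff, step_eq_zero ht, step_eq_one (by linarith)]
    ring

lemma tendsto_cutoff {T t : ℝ} (ht : t ∈ Ioo 0 T) :
    Tendsto (fun k => cutoff T k t) atTop (𝓝 1) := by
  have h1 : ∀ s : ℝ, 0 < s → ∀ᶠ k : ℕ in atTop, 2 ≤ k * s := fun s hs =>
    (tendsto_natCast_atTop_atTop.atTop_mul_const hs).eventually_ge_atTop 2
  refine tendsto_const_nhds.congr' ?_
  filter_upwards [h1 t ht.1, h1 (T - t) (sub_pos.2 ht.2)] with k h2 h3
  rw [cutoff, step_eq_one h2, step_eq_one h3]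
  ring

lemma isTestFunction_cutoff_mul {T : ℝ} {k : ℕ} (hk : 4 ≤ k * T) {a : ℝ → ℝ} (ha : ContDiff ℝ ∞ a)
    {b : UnitAddCircle → ℝ} (hb : TorusSmooth b) :
    IsTestFunction T fun z => cutoff T k z.1 * a z.1 * b z.2 := by
  have hk0 : (0 : ℝ) < k := by
    rcases Nat.eq_zero_or_pos k with rfl | h
    · norm_num at hk
    · exact_mod_cast h
  have hcl : IsClosed (Icc (1 / k : ℝ) (T - 1 / k) ×ˢ (univ : Set UnitAddCircle)) :=
    isClosed_Icc.prod isClosed_univ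
  have hsupp : tsupport (fun z : ℝ × UnitAddCircle => cutoff T k z.1 * a z.1 * b z.2)
      ⊆ Icc (1 / k : ℝ) (T - 1 / k) ×ˢ univ := by
    refine closure_minimal (fun z hz => ?_) hcl
    by_contra hcon
    refine hz ?_
    have : cutoff T k z.1 = 0 := by
      refine cutoff_eq_zero hk ?_
      by_contra! h
      refine hcon ⟨⟨?_, ?_⟩, mem_univ _⟩
      · rw [div_le_iff₀ hk0]
        linarith [h.1]
      · rw [le_sub_comm, div_le_iff₀ hk0]
        linarith [h.2]
    simp [this]
  refine ⟨?_, ?_, hsupp.trans (prod_mono (fun t ht => ⟨?_, ?_⟩) subset_rfl)⟩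
  · exact (((contDiff_cutoff T k).comp contDiff_fst).mul (ha.comp contDiff_fst)).mul
      (ContDiff.comp (g := fun x : ℝ => b (x : UnitAddCircle)) hb contDiff_snd)
  · exact (isCompact_Icc.prod isCompact_univ).of_isClosed_subset (isClosed_tsupport _) hsupp
  · exact lt_of_lt_of_le (by positivity) ht.1
  · exact lt_of_le_of_lt ht.2 (by simpa using hk0)

/-! ### Product test functions that need not vanish at the ends of the time interval -/

section Carried

variable {T : ℝ} {q : SignedMeasure (ℝ × UnitAddCircle)}

lemma isFiniteMeasure_variation {X : Type*} [MeasurableSpace X] (q : SignedMeasure X) :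
    IsFiniteMeasure q.variation := by
  rw [← SignedMeasure.totalVariation_eq_variation]
  infer_instance

lemma ae_variation_mem (hq : q.restrict (Ioo 0 T ×ˢ univ) = q) :
    ∀ᵐ z ∂q.variation, z.1 ∈ Ioo 0 T := by
  have h := VectorMeasure.variation_restrict (μ := q) (measurableSet_Ioo_prod T)
  rw [hq] at h
  rw [h]
  filter_upwards [ae_restrict_mem (measurableSet_Ioo_prod T)] with z hz using hz.1

lemma tendsto_integral_cutoff_mul (hq : q.restrict (Ioo 0 T ×ˢ univ) = q) {a : ℝ → ℝ}
    (ha : Continuous a) {b : UnitAddCircle → ℝ} (hb : TorusSmooth b) :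
    Tendsto (fun k => ∫ᵛ z, cutoff T k z.1 * a z.1 * b z.2 ∂<•q) atTop
      (𝓝 (∫ᵛ z, a z.1 * b z.2 ∂<•q)) := by
  have := isFiniteMeasure_variation q
  obtain ⟨C, -, hC⟩ := exists_bound_of_continuousOn (T := T)
    (ha.fst'.mul hb.continuous.snd').continuousOn
  refine VectorMeasure.tendsto_integral_of_dominated_convergence (fun _ => C) (fun k => ?_)
    (integrable_const _) (fun k => ?_) ?_
  · exact (((contDiff_cutoff T k).continuous.fst'.mul ha.fst').mul
      hb.continuous.snd').aestronglyMeasurable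
  · filter_upwards [ae_variation_mem hq] with z hz
    have h1 := hC z.1 (Ioo_subset_Icc_self hz) z.2
    rw [mul_assoc, norm_mul]
    calc _ ≤ 1 * C := mul_le_mul (abs_cutoff_le _) h1 (abs_nonneg _) zero_le_one
      _ = C := one_mul C
  · filter_upwards [ae_variation_mem hq] with z hz
    simpa [mul_assoc] using (tendsto_cutoff hz).mul_const (a z.1 * b z.2)

end Carried

namespace BVCompetitor

variable {T : ℝ} {W : ℝ → UnitAddCircle → ℝ} {q p : SignedMeasure (ℝ × UnitAddCircle)}

lemma integrable_mul (hW : BVCompetitor T W q p) {a : ℝ → ℝ} (ha : Continuous a)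
    {b : UnitAddCircle → ℝ} (hb : Continuous b) :
    Integrable (fun z : ℝ × UnitAddCircle => a z.1 * b z.2 * W z.1 z.2) (slab T) := by
  obtain ⟨C, -, hC⟩ := exists_bound_of_continuousOn (T := T) (ha.fst'.mul hb.snd').continuousOn
  refine hW.integrable.bdd_mul (ha.fst'.mul hb.snd').aestronglyMeasurable (c := C) ?_
  filter_upwards [ae_slab_mem T] with z hz using hC z.1 (Ioo_subset_Icc_self hz) z.2

lemma tendsto_integral_cutoff_mul (hW : BVCompetitor T W q p) {a : ℝ → ℝ} (ha : Continuous a)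
    {b : UnitAddCircle → ℝ} (hb : Continuous b) :
    Tendsto (fun k => ∫ z : ℝ × UnitAddCircle, cutoff T k z.1 * (a z.1 * b z.2 * W z.1 z.2) ∂(slab T))
      atTop (𝓝 (∫ z : ℝ × UnitAddCircle, a z.1 * b z.2 * W z.1 z.2 ∂(slab T))) := by
  refine tendsto_integral_of_dominated_convergence
    (fun z => ‖a z.1 * b z.2 * W z.1 z.2‖) (fun k => ?_) (hW.integrable_mul ha hb).norm
    (fun k => Eventually.of_forall fun z => ?_) ?_
  · exact (contDiff_cutoff T k).continuous.fst'.aestronglyMeasurable.mul (hW.integrable_mul ha hb).1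
  · rw [norm_mul]
    exact mul_le_of_le_one_left (norm_nonneg _) (abs_cutoff_le _)
  · filter_upwards [ae_slab_mem T] with z hz
    simpa using (tendsto_cutoff hz).mul_const (a z.1 * b z.2 * W z.1 z.2)

/-- The spatial derivative tested against `a(t) b(x)`, with no condition on `a` at `0` and `T`. -/
lemma integral_spaceDeriv (hT : 0 < T) (hW : BVCompetitor T W q p) {a : ℝ → ℝ}
    (ha : ContDiff ℝ ∞ a) {b : UnitAddCircle → ℝ} (hb : TorusSmooth b) :
    ∫ᵛ z, a z.1 * b z.2 ∂<•p
      = -∫ z : ℝ × UnitAddCircle, a z.1 * torusDeriv b z.2 * W z.1 z.2 ∂(slab T) := by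
  refine tendsto_nhds_unique (BurgersMax.tendsto_integral_cutoff_mul hW.spaceDeriv.1 ha.continuous hb)
    ((hW.tendsto_integral_cutoff_mul ha.continuous hb.torusDeriv.continuous).neg.congr' ?_)
  filter_upwards [(tendsto_natCast_atTop_atTop.atTop_mul_const hT).eventually_ge_atTop 4] with k hk
  rw [hW.spaceDeriv.2 _ (isTestFunction_cutoff_mul hk ha hb)]
  congr 1
  refine integral_congr_ae (Eventually.of_forall fun z => ?_)
  have : torusDeriv (fun y => cutoff T k z.1 * a z.1 * b y) z.2
      = cutoff T k z.1 * a z.1 * torusDeriv b z.2 := deriv_const_mul_field _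
  simp only [this]
  ring

/-- The time derivative tested against `a(t) b(x)`: as `W(T,·) = 0`, only the boundary term at time
`0` appears. With `a = 1` this is the equivalence of the two forms of the objective. -/
lemma integral_timeDeriv (hT : 0 < T) (hW : BVCompetitor T W q p) {a : ℝ → ℝ}
    (ha : ContDiff ℝ ∞ a) {b : UnitAddCircle → ℝ} (hb : TorusSmooth b) :
    ∫ᵛ z, a z.1 * b z.2 ∂<•q
      = -(∫ z : ℝ × UnitAddCircle, deriv a z.1 * b z.2 * W z.1 z.2 ∂(slab T))
        - a 0 * ∫ x, W 0 x * b x := by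
  have hda : Continuous (deriv a) := ha.continuous_deriv (by simp)
  -- `h` is the continuous extension of `a(t) ∫ W(t,·) b` from `[0,T]`
  set g : ℝ → ℝ := fun t => a t * ∫ x, W t x * b x with hg
  have hgc : ContinuousOn g (Icc 0 T) :=
    ha.continuous.continuousOn.mul (hW.uniformContinuous b hb).continuousOn
  set h : ℝ → ℝ := IccExtend hT.le ((Icc 0 T).domRestrict g) with hh
  have hhc : Continuous h := (continuousOn_iff_continuous_domRestrict.1 hgc).Icc_extend'
  have hhg : ∀ t ∈ Icc 0 T, h t = g t := fun t ht => by
    rw [hh, IccExtend_of_mem _ _ ht]; rfl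
  obtain ⟨C, hC⟩ := isCompact_Icc.exists_bound_of_continuousOn hgc
  have hCh : ∀ t, |h t| ≤ C := fun t => hC _ (projIcc 0 T hT.le t).2
  have hgT : g T = 0 := by
    have : ∫ x, W T x * b x = 0 := integral_eq_zero_of_ae (by
      filter_upwards [hW.final] with x hx
      simp [hx])
    simp [hg, this]
  have h0 := tendsto_integral_deriv_step hhc hCh
  have hT' := tendsto_integral_deriv_step (h := fun t => h (T - t)) (by fun_prop) fun t => hCh _
  have hlim := ((hW.tendsto_integral_cutoff_mul hda hb.continuous).neg.sub (h0.sub hT'))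
  rw [sub_zero, hhg T (right_mem_Icc.2 hT.le), hgT, hhg 0 (left_mem_Icc.2 hT.le), sub_zero] at hlim
  refine tendsto_nhds_unique (BurgersMax.tendsto_integral_cutoff_mul hW.timeDeriv.1 ha.continuous hb)
    (hlim.congr' ?_)
  filter_upwards [(tendsto_natCast_atTop_atTop.atTop_mul_const hT).eventually_ge_atTop 4] with k hk
  have hk0 : (0 : ℝ) < k := by
    rcases Nat.eq_zero_or_pos k with rfl | h
    · norm_num at hk
    · exact_mod_cast h
  have hd : ∀ t : ℝ, t ∉ Ioo 0 T → deriv step (k * t) = 0 := fun t ht =>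
    deriv_step_eq_zero fun h' => ht ⟨by nlinarith [h'.1], by nlinarith [h'.2]⟩
  have hd' : ∀ t : ℝ, t ∉ Ioo 0 T → deriv step (k * (T - t)) = 0 := fun t ht =>
    hd _ fun h' => ht ⟨by linarith [h'.2], by linarith [h'.1]⟩
  have hci : ∀ f : ℝ → ℝ, Continuous f → HasCompactSupport f → Integrable f := fun f h1 h2 =>
    h1.integrable_of_hasCompactSupport h2
  have hcs : ∀ f : ℝ → ℝ, (∀ t, t ∉ Ioo 0 T → f t = 0) → HasCompactSupport f := fun f hf =>
    HasCompactSupport.intro (isCompact_Icc (a := (0 : ℝ)) (b := T)) fun t ht =>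
      hf t fun h' => ht (Ioo_subset_Icc_self h')
  have hcc : Continuous fun t : ℝ => (k : ℝ) * deriv step (k * t) :=
    continuous_const.mul (continuous_deriv_step.comp (by fun_prop))
  have hcc' : Continuous fun t : ℝ => (k : ℝ) * deriv step (k * (T - t)) :=
    hcc.comp (continuous_const.sub continuous_id)
  have hI : (∫ t, k * deriv step (k * t) * h t) - ∫ t, k * deriv step (k * t) * h (T - t)
      = ∫ z : ℝ × UnitAddCircle, deriv (cutoff T k) z.1 * (a z.1 * b z.2 * W z.1 z.2) ∂(slab T) := by
    have h2 : ∫ t, k * deriv step (k * t) * h (T - t)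
        = ∫ t, k * deriv step (k * (T - t)) * h t := by
      rw [← integral_sub_left_eq_self _ volume T]
      simp only [sub_sub_cancel]
    have hi1 : Integrable fun t : ℝ => k * deriv step (k * t) * h t :=
      hci _ (hcc.mul hhc) (hcs _ fun t ht => by simp [hd t ht])
    have hi2 : Integrable fun t : ℝ => k * deriv step (k * (T - t)) * h t :=
      hci _ (hcc'.mul hhc) (hcs _ fun t ht => by simp [hd' t ht])
    rw [h2, ← integral_sub hi1 hi2]
    have h3 : Integrable (fun z : ℝ × UnitAddCircle =>
        deriv (cutoff T k) z.1 * (a z.1 * b z.2 * W z.1 z.2)) (slab T) := by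
      have hdc : Continuous (deriv (cutoff T k)) :=
        (contDiff_cutoff T k).continuous_deriv (by simp)
      have := hW.integrable_mul (hdc.mul ha.continuous) hb.continuous
      simpa only [Pi.mul_apply, mul_assoc] using this
    rw [integral_prod _ h3, ← setIntegral_eq_integral_of_forall_compl_eq_zero (s := Ioo 0 T)
      (fun t ht => by simp [hd t ht, hd' t ht])]
    refine setIntegral_congr_fun measurableSet_Ioo fun t ht => ?_
    simp only
    rw [integral_const_mul, deriv_cutoff, hhg t (Ioo_subset_Icc_self ht), hg, sub_mul]
    simp only [← integral_const_mul]
    simp only [mul_assoc, mul_comm (W _ _)]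
  rw [hI, hW.timeDeriv.2 _ (isTestFunction_cutoff_mul hk ha hb), ← neg_add', ← integral_add]
  · congr 1
    refine integral_congr_ae (Eventually.of_forall fun z => ?_)
    have hd1 : HasDerivAt (fun s => cutoff T k s * a s * b z.2)
        ((deriv (cutoff T k) z.1 * a z.1 + cutoff T k z.1 * deriv a z.1) * b z.2) z.1 :=
      (((contDiff_cutoff T k).differentiable (by simp) z.1).hasDerivAt.mul
        (ha.differentiable (by simp) z.1).hasDerivAt).mul_const _
    simp only [hd1.deriv]
    ring
  · have := hW.integrable_mul ((contDiff_cutoff T k).continuous.mul hda) hb.continuous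
    simpa only [Pi.mul_apply, mul_assoc] using this
  · have := hW.integrable_mul (((contDiff_cutoff T k).continuous_deriv (by simp)).mul ha.continuous)
      hb.continuous
    simpa only [Pi.mul_apply, mul_assoc] using this

/-- The two forms of the linear term coincide. -/
lemma integral_initial (hT : 0 < T) (hW : BVCompetitor T W q p) {b : UnitAddCircle → ℝ}
    (hb : TorusSmooth b) : ∫ᵛ z, b z.2 ∂<•q = -∫ x, W 0 x * b x := by
  simpa using hW.integral_timeDeriv hT (a := fun _ => 1) contDiff_const hb

lemma bvObjective'_eq (hT : 0 < T) (hW : BVCompetitor T W q p) {u₀ : UnitAddCircle → ℝ}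
    (hu₀ : TorusSmooth u₀) : bvObjective' T u₀ q p = bvObjective T u₀ W q p := by
  rw [bvObjective', bvObjective, hW.integral_initial hT hu₀, EReal.coe_neg]
  exact (sub_eq_add_neg _ _).symm

end BVCompetitor

namespace SmoothCompetitor

variable {T : ℝ} {W : ℝ → UnitAddCircle → ℝ} {u₀ : UnitAddCircle → ℝ}

lemma bvObjective_eq (hT : 0 < T) (hW : SmoothCompetitor T W) :
    bvObjective T u₀ W ((slab T).withDensityᵥ fun z => derivWithin (fun s => W s z.2) (Icc 0 T) z.1)
      ((slab T).withDensityᵥ fun z => torusDeriv (W z.1) z.2) = smoothObjective T u₀ W := by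
  rw [bvObjective, hW.measureAction_eq hT, smoothObjective]

lemma smoothObjective'_eq (hT : 0 < T) (hW : SmoothCompetitor T W) (hu₀ : TorusSmooth u₀) :
    smoothObjective' T u₀ W = smoothObjective T u₀ W := by
  obtain ⟨C, -, hC⟩ := hu₀.exists_bound
  rw [← hW.bvObjective_eq hT, ← (hW.bvCompetitor hT).bvObjective'_eq hT hu₀, bvObjective',
    hW.measureAction_eq hT, integral_withDensityᵥ (hW.integrable_timeDeriv hT)
      hu₀.continuous.snd'.aestronglyMeasurable fun z => hC z.2, smoothObjective']
  simp only [mul_comm]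

end SmoothCompetitor

lemma optimalValue'_eq {T : ℝ} (hT : 0 < T) {u₀ : UnitAddCircle → ℝ} (hu₀ : TorusSmooth u₀) :
    optimalValue' T u₀ = optimalValue T u₀ := by
  rw [optimalValue', optimalValue]
  congr 1
  ext c
  refine exists_congr fun W => and_congr_right fun hW => ?_
  rw [hW.smoothObjective'_eq hT hu₀]

/-! ### Integrals against smooth kernels -/

/-- The kernel `η(s - t) ζ(x - y)` at the point `z = (s, y)`. -/
noncomputable def kernel (η : ℝ → ℝ) (ζ : UnitAddCircle → ℝ) (t : ℝ) (x : UnitAddCircle)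
    (z : ℝ × UnitAddCircle) : ℝ := η (z.1 - t) * ζ (x - z.2)

section Kernel

variable {η : ℝ → ℝ} {ζ : UnitAddCircle → ℝ}

lemma continuous_kernel_uncurry (hη : Continuous η) (hζ : Continuous ζ) :
    Continuous fun w : (ℝ × UnitAddCircle) × (ℝ × UnitAddCircle) =>
      kernel η ζ w.1.1 w.1.2 w.2 := by
  unfold kernel
  fun_prop

lemma continuous_kernel (hη : Continuous η) (hζ : Continuous ζ) (t : ℝ) (x : UnitAddCircle) :
    Continuous (kernel η ζ t x) := by
  unfold kernel
  fun_prop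

lemma exists_kernel_bound (hη : Continuous η) (hηc : HasCompactSupport η) (hζ : Continuous ζ) :
    ∃ C, 0 ≤ C ∧ ∀ t x z, |kernel η ζ t x z| ≤ C := by
  obtain ⟨A, hA⟩ := hη.bounded_above_of_compact_support hηc
  obtain ⟨B, hB⟩ := hζ.bounded_above_of_compact_support (HasCompactSupport.of_compactSpace ζ)
  have hA0 : 0 ≤ A := (norm_nonneg _).trans (hA 0)
  refine ⟨A * B, mul_nonneg hA0 ((norm_nonneg _).trans (hB 0)), fun t x z => ?_⟩
  rw [kernel, abs_mul]
  exact mul_le_mul (hA _) (hB _) (abs_nonneg _) hA0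

variable {m : Measure (ℝ × UnitAddCircle)} {w : ℝ × UnitAddCircle → ℝ}

lemma integrable_kernel_mul (hη : Continuous η) (hηc : HasCompactSupport η) (hζ : Continuous ζ)
    (hw : Integrable w m) (t : ℝ) (x : UnitAddCircle) :
    Integrable (fun z => kernel η ζ t x z * w z) m := by
  obtain ⟨C, -, hC⟩ := exists_kernel_bound hη hηc hζ
  exact hw.bdd_mul (continuous_kernel hη hζ t x).aestronglyMeasurable
    (Eventually.of_forall fun z => hC t x z)

lemma hasFDerivAt_integral_kernel (hη : ContDiff ℝ ∞ η) (hηc : HasCompactSupport η)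
    (hζ : TorusSmooth ζ) (hw : Integrable w m) (y : ℝ × ℝ) :
    HasFDerivAt (fun y : ℝ × ℝ => ∫ z, kernel η ζ y.1 (y.2 : UnitAddCircle) z * w z ∂m)
      (-(∫ z, kernel (deriv η) ζ y.1 (y.2 : UnitAddCircle) z * w z ∂m) •
          ContinuousLinearMap.fst ℝ ℝ ℝ
        + (∫ z, kernel η (torusDeriv ζ) y.1 (y.2 : UnitAddCircle) z * w z ∂m) •
          ContinuousLinearMap.snd ℝ ℝ ℝ) y := by
  have hη' : Continuous (deriv η) := hη.continuous_deriv (by simp)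
  have hi1 := fun y : ℝ × ℝ => integrable_kernel_mul hη' hηc.deriv hζ.continuous hw y.1 y.2
  have hi2 := fun y : ℝ × ℝ =>
    integrable_kernel_mul hη.continuous hηc hζ.torusDeriv.continuous hw y.1 y.2
  obtain ⟨A, hA0, hA⟩ := exists_kernel_bound hη' hηc.deriv hζ.continuous
  obtain ⟨B, hB0, hB⟩ := exists_kernel_bound hη.continuous hηc hζ.torusDeriv.continuous
  have hj1 : Integrable (fun z => (-(kernel (deriv η) ζ y.1 (y.2 : UnitAddCircle) z * w z)) •
      ContinuousLinearMap.fst ℝ ℝ ℝ) m := (hi1 y).neg.smul_const _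
  have hj2 : Integrable (fun z => (kernel η (torusDeriv ζ) y.1 (y.2 : UnitAddCircle) z * w z) •
      ContinuousLinearMap.snd ℝ ℝ ℝ) m := (hi2 y).smul_const _
  have key := hasFDerivAt_integral_of_dominated_of_fderiv_le (𝕜 := ℝ) (μ := m)
    (F := fun (y : ℝ × ℝ) z => kernel η ζ y.1 (y.2 : UnitAddCircle) z * w z)
    (F' := fun (y : ℝ × ℝ) z =>
      (-(kernel (deriv η) ζ y.1 (y.2 : UnitAddCircle) z * w z)) • ContinuousLinearMap.fst ℝ ℝ ℝ
        + (kernel η (torusDeriv ζ) y.1 (y.2 : UnitAddCircle) z * w z) •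
          ContinuousLinearMap.snd ℝ ℝ ℝ)
    (x₀ := y) (s := univ) (bound := fun z => (A + B) * ‖w z‖) univ_mem
    (Eventually.of_forall fun y =>
      (integrable_kernel_mul hη.continuous hηc hζ.continuous hw y.1 y.2).1)
    (integrable_kernel_mul hη.continuous hηc hζ.continuous hw y.1 y.2)
    (hj1.1.add hj2.1)
    (Eventually.of_forall fun z y _ => ?_) (hw.norm.const_mul _)
    (Eventually.of_forall fun z y _ => ?_)
  · rw [integral_add hj1 hj2, integral_smul_const,
      integral_smul_const, integral_neg] at key
    exact key
  · refine (norm_add_le _ _).trans ?_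
    rw [norm_smul, norm_smul, norm_neg, norm_mul, norm_mul, add_mul]
    refine add_le_add ?_ ?_
    · refine (mul_le_of_le_one_right (by positivity) (ContinuousLinearMap.norm_fst_le ℝ ℝ ℝ)).trans ?_
      exact mul_le_mul_of_nonneg_right (hA _ _ _) (norm_nonneg _)
    · refine (mul_le_of_le_one_right (by positivity) (ContinuousLinearMap.norm_snd_le ℝ ℝ ℝ)).trans ?_
      exact mul_le_mul_of_nonneg_right (hB _ _ _) (norm_nonneg _)
  · obtain ⟨b, hb⟩ := isOpenQuotientMap_coe.surjective z.2
    have h1 : HasFDerivAt (fun y : ℝ × ℝ => η (z.1 - y.1))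
        ((deriv η (z.1 - y.1)) • (-ContinuousLinearMap.fst ℝ ℝ ℝ)) y :=
      ((hη.differentiable (by simp)) _).hasDerivAt.comp_hasFDerivAt y
        (hasFDerivAt_fst.const_sub z.1)
    have h2 : HasFDerivAt (fun y : ℝ × ℝ => ζ ((y.2 : UnitAddCircle) - z.2))
        ((torusDeriv ζ ((y.2 : UnitAddCircle) - z.2)) • ContinuousLinearMap.snd ℝ ℝ ℝ) y := by
      rw [← hb]
      have h0 : HasFDerivAt (fun y : ℝ × ℝ => y.2 - b) (ContinuousLinearMap.snd ℝ ℝ ℝ) y :=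
        hasFDerivAt_snd.sub_const b
      exact (hζ.hasDerivAt (y.2 - b)).comp_hasFDerivAt y h0
    refine ((h1.mul h2).mul_const (w z)).congr_fderiv ?_
    ext <;> simp [kernel] <;> ring

lemma contDiff_integral_kernel (hη : ContDiff ℝ ∞ η) (hηc : HasCompactSupport η)
    (hζ : TorusSmooth ζ) (hw : Integrable w m) :
    ContDiff ℝ ∞ fun y : ℝ × ℝ => ∫ z, kernel η ζ y.1 (y.2 : UnitAddCircle) z * w z ∂m := by
  refine contDiff_infty.2 fun n => ?_
  induction n generalizing η ζ with
  | zero =>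
    exact contDiff_zero.2 (continuous_iff_continuousAt.2 fun y =>
      (hasFDerivAt_integral_kernel hη hηc hζ hw y).continuousAt)
  | succ n ih =>
    refine contDiff_succ_iff_hasFDerivAt.2
      ⟨_, ?_, fun y => hasFDerivAt_integral_kernel hη hηc hζ hw y⟩
    exact (((ih (contDiff_infty_iff_deriv.1 hη).2 hηc.deriv hζ).neg).smul contDiff_const).add
      ((ih hη hηc hζ.torusDeriv).smul contDiff_const)

end Kernel

/-! ### Mollified competitors -/

/-- A pair of probability densities on `ℝ` and `𝕋`, smooth and compactly supported, the first one
supported in `(0, ∞)`. -/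
structure IsMollifier (η : ℝ → ℝ) (ζ : UnitAddCircle → ℝ) : Prop where
  smooth_time : ContDiff ℝ ∞ η
  compact_time : HasCompactSupport η
  nonneg_time : ∀ s, 0 ≤ η s
  support_time : ∀ s ≤ 0, η s = 0
  integral_time : ∫ s, η s = 1
  smooth_space : TorusSmooth ζ
  nonneg_space : ∀ x, 0 ≤ ζ x
  integral_space : ∫ x, ζ x = 1

/-- The mollification `∫ η(s - t) ζ(x - y) W(s, y) ds dy`. It only sees times `s > t`, so that no
extension of `W` below time `0` is needed, and `W` is in effect extended by `0` above time `T`. -/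
noncomputable def mollify (T : ℝ) (W : ℝ → UnitAddCircle → ℝ) (η : ℝ → ℝ) (ζ : UnitAddCircle → ℝ)
    (t : ℝ) (x : UnitAddCircle) : ℝ :=
  ∫ z, kernel η ζ t x z * W z.1 z.2 ∂(slab T)

namespace IsMollifier

variable {η : ℝ → ℝ} {ζ : UnitAddCircle → ℝ}

lemma kernel_nonneg (h : IsMollifier η ζ) (t : ℝ) (x : UnitAddCircle) (z : ℝ × UnitAddCircle) :
    0 ≤ kernel η ζ t x z :=
  mul_nonneg (h.nonneg_time _) (h.nonneg_space _)

lemma exists_bound (h : IsMollifier η ζ) : ∃ C, 0 ≤ C ∧ ∀ t x z, |kernel η ζ t x z| ≤ C :=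
  exists_kernel_bound h.smooth_time.continuous h.compact_time h.smooth_space.continuous

lemma continuous_kernel (h : IsMollifier η ζ) (t : ℝ) (x : UnitAddCircle) :
    Continuous (kernel η ζ t x) :=
  BurgersMax.continuous_kernel h.smooth_time.continuous h.smooth_space.continuous t x

lemma integrable_mul (h : IsMollifier η ζ) {m : Measure (ℝ × UnitAddCircle)}
    {w : ℝ × UnitAddCircle → ℝ} (hw : Integrable w m) (t : ℝ) (x : UnitAddCircle) :
    Integrable (fun z => kernel η ζ t x z * w z) m :=
  integrable_kernel_mul h.smooth_time.continuous h.compact_time h.smooth_space.continuous hw t x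

lemma integrable_kernel (h : IsMollifier η ζ) (m : Measure (ℝ × UnitAddCircle)) [IsFiniteMeasure m]
    (t : ℝ) (x : UnitAddCircle) : Integrable (kernel η ζ t x) m := by
  simpa using h.integrable_mul (integrable_const (1 : ℝ)) t x

lemma integrable_time (h : IsMollifier η ζ) : Integrable η :=
  h.smooth_time.continuous.integrable_of_hasCompactSupport h.compact_time

lemma integral_kernel_le (h : IsMollifier η ζ) (T t : ℝ) (x : UnitAddCircle) :
    ∫ z, kernel η ζ t x z ∂(slab T) ≤ 1 := by
  unfold kernel
  rw [integral_prod_mul (fun s => η (s - t)) (fun y => ζ (x - y)),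
    integral_sub_left_eq_self ζ volume x, h.integral_space, mul_one, ← h.integral_time,
    ← integral_sub_right_eq_self η t]
  exact setIntegral_le_integral (h.integrable_time.comp_sub_right t)
    (Eventually.of_forall fun s => h.nonneg_time _)

lemma lintegral_kernel_le (h : IsMollifier η ζ) (T : ℝ) (z : ℝ × UnitAddCircle) :
    ∫⁻ w, ENNReal.ofReal (kernel η ζ w.1 w.2 z) ∂(slab T) ≤ 1 := by
  have hc : Continuous fun w : ℝ × UnitAddCircle => kernel η ζ w.1 w.2 z :=
    (continuous_kernel_uncurry h.smooth_time.continuous h.smooth_space.continuous).comp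
      (continuous_id.prodMk continuous_const)
  obtain ⟨C, -, hC⟩ := h.exists_bound
  rw [← ofReal_integral_eq_lintegral_ofReal (Integrable.of_bound hc.aestronglyMeasurable C
    (Eventually.of_forall fun w => hC _ _ _)) (Eventually.of_forall fun w => h.kernel_nonneg _ _ _)]
  rw [← ENNReal.ofReal_one]
  refine ENNReal.ofReal_le_ofReal ?_
  unfold kernel
  rw [integral_prod_mul (fun t => η (z.1 - t)) (fun x => ζ (x - z.2)),
    integral_sub_right_eq_self ζ z.2, h.integral_space, mul_one, ← h.integral_time,
    ← integral_sub_left_eq_self η volume z.1]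
  exact setIntegral_le_integral (h.integrable_time.comp_sub_left z.1)
    (Eventually.of_forall fun s => h.nonneg_time _)

end IsMollifier

/-- The Cauchy–Schwarz inequality with a nonnegative weight. -/
lemma sq_integral_mul_le {X : Type*} [MeasurableSpace X] {μ : Measure X} {k v : X → ℝ}
    (hk : ∀ z, 0 ≤ k z) (hki : Integrable k μ) (h1 : Integrable (fun z => k z * v z) μ)
    (h2 : Integrable (fun z => k z * v z ^ 2) μ) :
    (∫ z, k z * v z ∂μ) ^ 2 ≤ (∫ z, k z * v z ^ 2 ∂μ) * ∫ z, k z ∂μ := by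
  have h : ∀ c : ℝ, 0 ≤ (∫ z, k z ∂μ) * (c * c) + (-2 * ∫ z, k z * v z ∂μ) * c
      + ∫ z, k z * v z ^ 2 ∂μ := by
    intro c
    have : 0 ≤ ∫ z, k z * (c - v z) ^ 2 ∂μ :=
      integral_nonneg fun z => mul_nonneg (hk z) (sq_nonneg _)
    have e : ∀ z, k z * (c - v z) ^ 2
        = (c * c) * k z + (-2 * c) * (k z * v z) + k z * v z ^ 2 := fun z => by ring
    simp_rw [e] at this
    have h3 : Integrable (fun z => c * c * k z + -2 * c * (k z * v z)) μ :=
      (hki.const_mul _).add (h1.const_mul _)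
    rw [integral_add h3 h2, integral_add (hki.const_mul _) (h1.const_mul _), integral_const_mul,
      integral_const_mul] at this
    linarith
  have := discrim_le_zero h
  rw [discrim] at this
  nlinarith

namespace BVCompetitor

variable {T : ℝ} {W : ℝ → UnitAddCircle → ℝ} {q p : SignedMeasure (ℝ × UnitAddCircle)}
  {η : ℝ → ℝ} {ζ : UnitAddCircle → ℝ} {μ : Measure (ℝ × UnitAddCircle)}
  {v : ℝ × UnitAddCircle → ℝ}

lemma contDiff_mollify (hW : BVCompetitor T W q p) (h : IsMollifier η ζ) :
    ContDiff ℝ ∞ fun z : ℝ × ℝ => mollify T W η ζ z.1 (z.2 : UnitAddCircle) :=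
  contDiff_integral_kernel h.smooth_time h.compact_time h.smooth_space hW.integrable

lemma derivWithin_mollify (hT : 0 < T) (hW : BVCompetitor T W q p)
    (h : IsMollifier η ζ)
    (hv : Integrable v μ) (hq : q = μ.withDensityᵥ v) {t : ℝ} (ht : t ∈ Icc 0 T)
    (x : UnitAddCircle) :
    derivWithin (fun s => mollify T W η ζ s x) (Icc 0 T) t = ∫ z, kernel η ζ t x z * v z ∂μ := by
  obtain ⟨C, -, hC⟩ := h.exists_bound
  obtain ⟨y, rfl⟩ := isOpenQuotientMap_coe.surjective x
  have h1 : HasDerivAt (fun s => mollify T W η ζ s (y : UnitAddCircle))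
      (-∫ z, kernel (deriv η) ζ t (y : UnitAddCircle) z * W z.1 z.2 ∂(slab T)) t := by
    have := (hasFDerivAt_integral_kernel h.smooth_time h.compact_time h.smooth_space hW.integrable
      (t, y)).comp_hasDerivAt (f := fun s => (s, y)) t
      ((hasDerivAt_id t).prodMk (hasDerivAt_const t y))
    refine this.congr_deriv ?_
    simp
  rw [h1.hasDerivWithinAt.derivWithin (uniqueDiffOn_Icc hT t ht), ← integral_withDensityᵥ hv
    (h.continuous_kernel t y).aestronglyMeasurable (hC t y), ← hq]
  have h2 := hW.integral_timeDeriv hT (a := fun s => η (s - t))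
    (h.smooth_time.comp (contDiff_id.sub contDiff_const)) (h.smooth_space.comp_sub y)
  have h3 : ∀ s, deriv (fun s => η (s - t)) s = deriv η (s - t) := fun s =>
    deriv_comp_sub_const η t s
  simp only [h3, h.support_time (0 - t) (by linarith [ht.1]), zero_mul, sub_zero] at h2
  exact h2.symm

lemma torusDeriv_mollify [IsFiniteMeasure μ] (hT : 0 < T) (hW : BVCompetitor T W q p)
    (h : IsMollifier η ζ)
    (hμ : μ.toSignedMeasure = (slab T).toSignedMeasure - p) (t : ℝ) (x : UnitAddCircle) :
    torusDeriv (mollify T W η ζ t) x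
      = ∫ z, kernel η ζ t x z ∂(slab T) - ∫ z, kernel η ζ t x z ∂μ := by
  obtain ⟨y, rfl⟩ := isOpenQuotientMap_coe.surjective x
  have h1 : HasDerivAt (fun x : ℝ => mollify T W η ζ t (x : UnitAddCircle))
      (∫ z, kernel η (torusDeriv ζ) t (y : UnitAddCircle) z * W z.1 z.2 ∂(slab T)) y := by
    have := (hasFDerivAt_integral_kernel h.smooth_time h.compact_time h.smooth_space hW.integrable
      (t, y)).comp_hasDerivAt (f := fun x => (t, x)) y
      ((hasDerivAt_const y t).prodMk (hasDerivAt_id y))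
    refine this.congr_deriv ?_
    simp
  have hp : p = (slab T).toSignedMeasure - μ.toSignedMeasure := by rw [hμ, sub_sub_cancel]
  rw [torusDeriv_coe, h1.deriv, ← integral_sub_toSignedMeasure (h.integrable_kernel _ t y)
    (h.integrable_kernel _ t y), ← hp]
  have h2 := hW.integral_spaceDeriv hT (a := fun s => η (s - t))
    (h.smooth_time.comp (contDiff_id.sub contDiff_const)) (h.smooth_space.comp_sub y)
  simp only [torusDeriv_comp_sub, mul_neg, neg_mul, integral_neg, neg_neg] at h2
  exact h2.symm

/-- The mass density of the mollification dominates the mollified mass; the difference is the mass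
of the extension by `0` above time `T`. -/
lemma integral_kernel_le [IsFiniteMeasure μ] (hT : 0 < T) (hW : BVCompetitor T W q p)
    (h : IsMollifier η ζ)
    (hμ : μ.toSignedMeasure = (slab T).toSignedMeasure - p) (t : ℝ) (x : UnitAddCircle) :
    ∫ z, kernel η ζ t x z ∂μ ≤ 1 - torusDeriv (mollify T W η ζ t) x := by
  rw [hW.torusDeriv_mollify hT h hμ]
  linarith [h.integral_kernel_le T t x]

lemma sq_derivWithin_mollify_le [IsFiniteMeasure μ] (hT : 0 < T) (hW : BVCompetitor T W q p)
    (h : IsMollifier η ζ)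
    (hμ : μ.toSignedMeasure = (slab T).toSignedMeasure - p) (hv : Integrable v μ)
    (hv2 : Integrable (fun z => v z ^ 2) μ) (hq : q = μ.withDensityᵥ v) {t : ℝ}
    (ht : t ∈ Icc 0 T) (x : UnitAddCircle) :
    derivWithin (fun s => mollify T W η ζ s x) (Icc 0 T) t ^ 2
      ≤ (∫ z, kernel η ζ t x z * v z ^ 2 ∂μ) * (1 - torusDeriv (mollify T W η ζ t) x) := by
  rw [hW.derivWithin_mollify hT h hv hq ht]
  refine (sq_integral_mul_le (h.kernel_nonneg t x) (h.integrable_kernel μ t x)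
    (h.integrable_mul hv t x) (h.integrable_mul hv2 t x)).trans ?_
  exact mul_le_mul_of_nonneg_left (hW.integral_kernel_le hT h hμ t x)
    (integral_nonneg fun z => mul_nonneg (h.kernel_nonneg _ _ _) (sq_nonneg _))

lemma smoothCompetitor_mollify [IsFiniteMeasure μ] (hT : 0 < T) (hW : BVCompetitor T W q p)
    (h : IsMollifier η ζ)
    (hμ : μ.toSignedMeasure = (slab T).toSignedMeasure - p) (hv : Integrable v μ)
    (hv2 : Integrable (fun z => v z ^ 2) μ) (hq : q = μ.withDensityᵥ v) :
    SmoothCompetitor T (mollify T W η ζ) := by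
  refine ⟨(hW.contDiff_mollify h).contDiffOn, fun x => ?_, fun t _ x => ?_, fun t ht x h1 => ?_⟩
  · refine integral_eq_zero_of_ae ?_
    filter_upwards [ae_slab_mem T] with z hz
    simp [kernel, h.support_time (z.1 - T) (by linarith [hz.2])]
  · have := hW.integral_kernel_le hT h hμ t x
    linarith [integral_nonneg (μ := μ) (f := kernel η ζ t x) fun z => h.kernel_nonneg t x z]
  · have := hW.sq_derivWithin_mollify_le hT h hμ hv hv2 hq ht x
    rw [h1, sub_self, mul_zero] at this
    exact pow_eq_zero_iff (two_ne_zero) |>.1 (le_antisymm this (sq_nonneg _))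

/-- Mollification does not increase the action: pointwise by the Cauchy–Schwarz inequality, then
by Tonelli's theorem. -/
lemma smoothAction_mollify_le [IsFiniteMeasure μ] (hT : 0 < T) (hW : BVCompetitor T W q p)
    (h : IsMollifier η ζ)
    (hμ : μ.toSignedMeasure = (slab T).toSignedMeasure - p) (hv : Integrable v μ)
    (hv2 : Integrable (fun z => v z ^ 2) μ) (hq : q = μ.withDensityᵥ v) :
    smoothAction T (mollify T W η ζ) ≤ ∫⁻ z, ENNReal.ofReal (v z ^ 2 / 2) ∂μ := by
  have hmeas : AEMeasurable (fun z => ENNReal.ofReal (v z ^ 2 / 2)) μ :=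
    ((hv.1.aemeasurable.pow_const 2).div_const 2).ennreal_ofReal
  calc smoothAction T (mollify T W η ζ)
      ≤ ∫⁻ w, ∫⁻ z, ENNReal.ofReal (kernel η ζ w.1 w.2 z) * ENNReal.ofReal (v z ^ 2 / 2) ∂μ
        ∂(slab T) := by
        refine lintegral_mono_ae ?_
        filter_upwards [ae_slab_mem T] with w hw
        have hk0 := h.kernel_nonneg w.1 w.2
        have hi : Integrable (fun z => kernel η ζ w.1 w.2 z * (v z ^ 2 / 2)) μ :=
          h.integrable_mul (hv2.div_const 2) _ _
        have hN : ∫ z, kernel η ζ w.1 w.2 z * (v z ^ 2 / 2) ∂μ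
            = (∫ z, kernel η ζ w.1 w.2 z * v z ^ 2 ∂μ) / 2 := by
          rw [← integral_div]
          simp only [mul_div_assoc]
        have hN0 : 0 ≤ ∫ z, kernel η ζ w.1 w.2 z * v z ^ 2 ∂μ :=
          integral_nonneg fun z => mul_nonneg (hk0 z) (sq_nonneg _)
        simp_rw [← ENNReal.ofReal_mul (hk0 _)]
        rw [← ofReal_integral_eq_lintegral_ofReal hi (Eventually.of_forall fun z =>
          mul_nonneg (hk0 z) (by positivity)), hN]
        refine ENNReal.ofReal_le_ofReal ?_
        have hR : 0 ≤ 1 - torusDeriv (mollify T W η ζ w.1) w.2 :=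
          (integral_nonneg hk0).trans (hW.integral_kernel_le hT h hμ w.1 w.2)
        have hsq := hW.sq_derivWithin_mollify_le hT h hμ hv hv2 hq (Ioo_subset_Icc_self hw) w.2
        refine div_le_of_le_mul₀ (by positivity) (by positivity) ?_
        linarith
    _ = ∫⁻ z, (∫⁻ w, ENNReal.ofReal (kernel η ζ w.1 w.2 z) ∂(slab T))
          * ENNReal.ofReal (v z ^ 2 / 2) ∂μ := by
        rw [lintegral_lintegral_swap]
        · refine lintegral_congr fun z => ?_
          rw [lintegral_mul_const]
          exact ((continuous_kernel_uncurry h.smooth_time.continuous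
            h.smooth_space.continuous).comp
            (continuous_id.prodMk continuous_const)).measurable.ennreal_ofReal
        · exact ((continuous_kernel_uncurry h.smooth_time.continuous
            h.smooth_space.continuous).measurable.ennreal_ofReal.aemeasurable).mul
            hmeas.comp_snd
    _ ≤ ∫⁻ z, ENNReal.ofReal (v z ^ 2 / 2) ∂μ :=
        lintegral_mono fun z => mul_le_of_le_one_left zero_le (h.lintegral_kernel_le T z)

/-- The linear term of a mollification, with the kernel moved to the datum. -/
lemma integral_mollify [IsFiniteMeasure μ] (hT : 0 < T) (hW : BVCompetitor T W q p)
    (h : IsMollifier η ζ)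
    (hv : Integrable v μ) (hq : q = μ.withDensityᵥ v) {u₀ : UnitAddCircle → ℝ}
    (hu₀ : TorusSmooth u₀) :
    ∫ w : ℝ × UnitAddCircle, derivWithin (fun s => mollify T W η ζ s w.2) (Icc 0 T) w.1 * u₀ w.2
        ∂(slab T)
      = ∫ z, (∫ t in Ioo 0 T, η (z.1 - t)) * (∫ x, ζ (x - z.2) * u₀ x) * v z ∂μ := by
  obtain ⟨C, hC0, hC⟩ := h.exists_bound
  obtain ⟨D, -, hD⟩ := hu₀.exists_bound
  have e1 : ∫ w : ℝ × UnitAddCircle,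
      derivWithin (fun s => mollify T W η ζ s w.2) (Icc 0 T) w.1 * u₀ w.2 ∂(slab T)
      = ∫ w : ℝ × UnitAddCircle, ∫ z, kernel η ζ w.1 w.2 z * u₀ w.2 * v z ∂μ ∂(slab T) := by
    refine integral_congr_ae ?_
    filter_upwards [ae_slab_mem T] with w hw
    rw [hW.derivWithin_mollify hT h hv hq (Ioo_subset_Icc_self hw), ← integral_mul_const]
    refine integral_congr_ae (Eventually.of_forall fun z => ?_)
    simp only
    ring
  rw [e1, integral_integral_swap]
  · refine integral_congr_ae (Eventually.of_forall fun z => ?_)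
    simp only
    rw [integral_mul_const]
    congr 1
    rw [← integral_prod_mul (fun t => η (z.1 - t)) (fun x => ζ (x - z.2) * u₀ x)]
    simp only [kernel, mul_assoc]
  · refine (hv.comp_snd (slab T)).bdd_mul (c := C * D) ?_ (Eventually.of_forall fun w => ?_)
    · exact ((continuous_kernel_uncurry h.smooth_time.continuous h.smooth_space.continuous).mul
        (hu₀.continuous.comp (continuous_snd.comp continuous_fst))).aestronglyMeasurable
    · rw [norm_mul]
      exact mul_le_mul (hC _ _ _) (hD _) (abs_nonneg _) hC0

end BVCompetitor

/-! ### A sequence of mollifiers -/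

/-- Smooth probability densities on `ℝ`, supported in `(1/k, 2/k)`. -/
noncomputable def timeBump (k : ℕ) (s : ℝ) : ℝ := k * deriv step (k * s)

lemma hasDerivAt_step_mul_sub (k : ℕ) (s t : ℝ) :
    HasDerivAt (fun t => -step (k * (s - t))) (timeBump k (s - t)) t := by
  have h : HasDerivAt (fun t : ℝ => step (k * (s - t))) (deriv step (k * (s - t)) * (k * (-1))) t :=
    (hasDerivAt_step _).comp t (((hasDerivAt_id t).const_sub s).const_mul (k : ℝ))
  refine h.neg.congr_deriv ?_
  rw [timeBump]
  ring

lemma contDiff_timeBump (k : ℕ) : ContDiff ℝ ∞ (timeBump k) :=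
  contDiff_const.mul ((contDiff_infty_iff_deriv.1 contDiff_step).2.comp
    (contDiff_const.mul contDiff_id))

lemma timeBump_nonneg (k : ℕ) (s : ℝ) : 0 ≤ timeBump k s := by
  have hmono : Monotone step := fun x y h =>
    Real.smoothTransition.monotone (sub_le_sub_right h 1)
  exact mul_nonneg (Nat.cast_nonneg _) hmono.deriv_nonneg

lemma integral_timeBump {k : ℕ} (hk : 0 < k) : ∫ s, timeBump k s = 1 := by
  have hk' : (0 : ℝ) < k := by exact_mod_cast hk
  have h := Measure.integral_comp_mul_left (deriv step) (k : ℝ)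
  rw [abs_of_pos (inv_pos.2 hk'), smul_eq_mul, integral_deriv_step, mul_one] at h
  simp only [timeBump]
  rw [integral_const_mul, h, mul_inv_cancel₀ hk'.ne']

lemma hasCompactSupport_timeBump {k : ℕ} (hk : 0 < k) : HasCompactSupport (timeBump k) := by
  have hk' : (0 : ℝ) < k := by exact_mod_cast hk
  refine HasCompactSupport.intro (isCompact_Icc (a := (0 : ℝ)) (b := 2 / k)) fun s hs => ?_
  rw [timeBump, deriv_step_eq_zero, mul_zero]
  refine fun h => hs ⟨?_, ?_⟩
  · by_contra! h0
    nlinarith [h.1]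
  · rw [le_div_iff₀ hk']
    linarith [h.2]

lemma setIntegral_timeBump {T s : ℝ} (hT : 0 < T) (hs : s ≤ T) (k : ℕ) :
    ∫ t in Ioo 0 T, timeBump k (s - t) = step (k * s) := by
  rw [← integral_Ioc_eq_integral_Ioo, ← intervalIntegral.integral_of_le hT.le,
    intervalIntegral.integral_eq_sub_of_hasDerivAt (fun t _ => hasDerivAt_step_mul_sub k s t)
      (((contDiff_timeBump k).continuous.comp (by fun_prop)).intervalIntegrable _ _), sub_zero,
    step_eq_zero (x := k * (s - T))]
  · ring
  · have : (k : ℝ) * (s - T) ≤ 0 := mul_nonpos_of_nonneg_of_nonpos (Nat.cast_nonneg _) (by linarith)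
    linarith

/-- The function `(1 + cos 2πx) / 2` on the torus; it has a unique maximum, at `0`. -/
noncomputable def torusPeak : UnitAddCircle → ℝ :=
  Function.Periodic.lift (f := fun x : ℝ => (1 + Real.cos (2 * Real.pi * x)) / 2) fun x => by
    simp [mul_add, Real.cos_add_two_pi]

lemma torusPeak_coe (x : ℝ) :
    torusPeak (x : UnitAddCircle) = (1 + Real.cos (2 * Real.pi * x)) / 2 := rfl

lemma torusSmooth_torusPeak : TorusSmooth torusPeak :=
  (contDiff_const.add (Real.contDiff_cos.comp (contDiff_const.mul contDiff_id))).div_const 2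

lemma torusPeak_nonneg (x : UnitAddCircle) : 0 ≤ torusPeak x := by
  obtain ⟨x, rfl⟩ := isOpenQuotientMap_coe.surjective x
  rw [torusPeak_coe]
  linarith [Real.neg_one_le_cos (2 * Real.pi * x)]

lemma torusPeak_zero : torusPeak 0 = 1 := by
  have := torusPeak_coe 0
  simpa using this

lemma torusPeak_lt {x : UnitAddCircle} (hx : x ≠ 0) : torusPeak x < torusPeak 0 := by
  obtain ⟨x, rfl⟩ := isOpenQuotientMap_coe.surjective x
  rw [torusPeak_zero, torusPeak_coe]
  refine lt_of_le_of_ne (by linarith [Real.cos_le_one (2 * Real.pi * x)]) fun h => hx ?_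
  obtain ⟨n, hn⟩ := (Real.cos_eq_one_iff (2 * Real.pi * x)).1 (by linarith)
  have : (n : ℝ) = x := by
    have := Real.pi_pos
    have h2 : (2 * Real.pi) * (n - x) = 0 := by linarith
    rcases mul_eq_zero.1 h2 with h3 | h3 <;> linarith
  rw [← this]
  exact (AddCircle.coe_eq_zero_iff 1).2 ⟨n, by simp⟩

/-- Smooth probability densities on the torus, concentrating at `0` as `k → ∞`. -/
noncomputable def spaceBump (k : ℕ) (x : UnitAddCircle) : ℝ :=
  (∫ y, torusPeak y ^ k)⁻¹ * torusPeak x ^ k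

lemma torusSmooth_torusPeak_pow (k : ℕ) : TorusSmooth fun x => torusPeak x ^ k :=
  ContDiff.pow torusSmooth_torusPeak k

lemma integral_torusPeak_pow_pos (k : ℕ) : 0 < ∫ y, torusPeak y ^ k :=
  (torusSmooth_torusPeak_pow k).continuous.integral_pos_of_hasCompactSupport_nonneg_nonzero
    (HasCompactSupport.of_compactSpace _) (fun x => pow_nonneg (torusPeak_nonneg x) k)
    (x := 0) (by simp [torusPeak_zero])

lemma tendsto_integral_spaceBump {u : UnitAddCircle → ℝ} (hu : Continuous u) (y : UnitAddCircle) :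
    Tendsto (fun k => ∫ x, spaceBump k (x - y) * u x) atTop (𝓝 (u y)) := by
  have h := tendsto_setIntegral_pow_smul_of_unique_maximum_of_isCompact_of_continuousOn
    (μ := (volume : Measure UnitAddCircle)) (x₀ := 0) (c := torusPeak) (g := fun x => u (x + y))
    isCompact_univ torusSmooth_torusPeak.continuous.continuousOn (fun x _ hx => torusPeak_lt hx)
    (fun x _ => torusPeak_nonneg x) (by simp [torusPeak_zero]) (by simp)
    (by fun_prop : Continuous fun x => u (x + y)).continuousOn
  simp only [Measure.restrict_univ, zero_add] at h
  refine h.congr fun k => ?_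
  rw [← integral_add_right_eq_self (fun x => spaceBump k (x - y) * u x) y, smul_eq_mul,
    ← integral_const_mul]
  simp [spaceBump, mul_assoc]

lemma isMollifier_bump {k : ℕ} (hk : 0 < k) : IsMollifier (timeBump k) (spaceBump k) where
  smooth_time := contDiff_timeBump k
  compact_time := hasCompactSupport_timeBump hk
  nonneg_time := timeBump_nonneg k
  support_time s hs := by
    rw [timeBump, deriv_step_eq_zero, mul_zero]
    exact fun h => absurd h.1 (not_lt.2 ((mul_nonpos_of_nonneg_of_nonpos (Nat.cast_nonneg _) hs).trans
      zero_le_one))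
  integral_time := integral_timeBump hk
  smooth_space := contDiff_const.mul (torusSmooth_torusPeak_pow k)
  nonneg_space x := mul_nonneg (inv_nonneg.2 (integral_torusPeak_pow_pos k).le)
    (pow_nonneg (torusPeak_nonneg x) k)
  integral_space := by
    simp only [spaceBump]
    rw [integral_const_mul, inv_mul_cancel₀ (integral_torusPeak_pow_pos k).ne']

/-! ### Generalized competitors do not exceed the smooth supremum -/

lemma smoothObjective'_le {T : ℝ} {u₀ : UnitAddCircle → ℝ} {W : ℝ → UnitAddCircle → ℝ}
    (hW : SmoothCompetitor T W) : smoothObjective' T u₀ W ≤ optimalValue' T u₀ :=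
  le_sSup ⟨W, hW, rfl⟩

namespace BVCompetitor

variable {T : ℝ} {W : ℝ → UnitAddCircle → ℝ} {q p : SignedMeasure (ℝ × UnitAddCircle)}

lemma ae_mem (hW : BVCompetitor T W q p) {μ : Measure (ℝ × UnitAddCircle)} [IsFiniteMeasure μ]
    (hμ : μ.toSignedMeasure = (slab T).toSignedMeasure - p) : ∀ᵐ z ∂μ, z.1 ∈ Ioo 0 T := by
  have hS := measurableSet_Ioo_prod T
  have hp : p (Ioo 0 T ×ˢ univ)ᶜ = 0 := by
    rw [← hW.spaceDeriv.1, VectorMeasure.restrict_apply _ hS hS.compl]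
    simp
  have hs : slab T (Ioo 0 T ×ˢ univ)ᶜ = 0 := by
    have := ae_slab_mem T
    rw [ae_iff] at this
    convert this using 2
    ext z
    simp
  have h := congrArg (fun s : SignedMeasure (ℝ × UnitAddCircle) => s (Ioo 0 T ×ˢ univ)ᶜ) hμ
  simp only [_root_.sub_apply, hp, Measure.toSignedMeasure_apply_measurable hS.compl,
    measureReal_def, hs, ENNReal.toReal_zero, sub_zero] at h
  have h' := (ENNReal.toReal_eq_zero_iff _).1 h |>.resolve_right (measure_ne_top _ _)
  rw [ae_iff]
  convert h' using 2
  ext z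
  simp

/-- The action-minus-linear functional of a generalized competitor of finite action is a limit of
values at mollified competitors, hence at most the supremum over smooth competitors. -/
lemma le_optimalValue' (hT : 0 < T) (hW : BVCompetitor T W q p)
    {μ : Measure (ℝ × UnitAddCircle)} [IsFiniteMeasure μ] {v : ℝ × UnitAddCircle → ℝ}
    (hμ : μ.toSignedMeasure = (slab T).toSignedMeasure - p) (hv : Integrable v μ)
    (hq : q = μ.withDensityᵥ v) (hfin : ∫⁻ z, ENNReal.ofReal (v z ^ 2 / 2) ∂μ ≠ ⊤)
    {u₀ : UnitAddCircle → ℝ} (hu₀ : TorusSmooth u₀) :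
    -((∫⁻ z, ENNReal.ofReal (v z ^ 2 / 2) ∂μ : ℝ≥0∞) : EReal) + ((∫ᵛ z, u₀ z.2 ∂<•q : ℝ) : EReal)
      ≤ optimalValue' T u₀ := by
  obtain ⟨D, hD0, hD⟩ := hu₀.exists_bound
  have hv2 : Integrable (fun z => v z ^ 2) μ := by
    have h1 : Integrable (fun z => v z ^ 2 / 2) μ :=
      ⟨((hv.1.aemeasurable.pow_const 2).div_const 2).aestronglyMeasurable,
        (hasFiniteIntegral_iff_ofReal (Eventually.of_forall fun z => by positivity)).2
          hfin.lt_top⟩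
    simpa using h1.mul_const 2
  set A := ∫⁻ z, ENNReal.ofReal (v z ^ 2 / 2) ∂μ with hA
  have hL : Tendsto (fun k : ℕ => ∫ z, (∫ t in Ioo 0 T, timeBump k (z.1 - t))
      * (∫ x, spaceBump k (x - z.2) * u₀ x) * v z ∂μ) atTop (𝓝 (∫ z, u₀ z.2 * v z ∂μ)) := by
    refine tendsto_integral_filter_of_dominated_convergence (fun z => D * ‖v z‖) ?_ ?_
      (hv.norm.const_mul D) ?_
    · refine Eventually.of_forall fun k => AEStronglyMeasurable.mul
        (StronglyMeasurable.mul ?_ ?_).aestronglyMeasurable hv.1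
      · have : Continuous fun w : ℝ × ℝ => timeBump k (w.1 - w.2) :=
          (contDiff_timeBump k).continuous.comp (by fun_prop)
        exact (this.stronglyMeasurable.integral_prod_right'
          (ν := volume.restrict (Ioo 0 T))).comp_measurable measurable_fst
      · have hsb : Continuous (spaceBump k) :=
          continuous_const.mul (torusSmooth_torusPeak_pow k).continuous
        have : Continuous fun w : UnitAddCircle × UnitAddCircle =>
            spaceBump k (w.2 - w.1) * u₀ w.2 :=
          (hsb.comp (by fun_prop)).mul (hu₀.continuous.comp continuous_snd)
        exact (this.stronglyMeasurable.integral_prod_right'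
          (ν := (volume : Measure UnitAddCircle))).comp_measurable measurable_snd
    · filter_upwards [eventually_gt_atTop 0] with k hk
      have hm := isMollifier_bump hk
      filter_upwards [hW.ae_mem hμ] with z hz
      rw [setIntegral_timeBump hT hz.2.le, norm_mul, norm_mul, Real.norm_of_nonneg (step_nonneg _)]
      refine mul_le_mul_of_nonneg_right ?_ (norm_nonneg _)
      refine (mul_le_of_le_one_left (norm_nonneg _) (step_le_one _)).trans ?_
      refine (norm_integral_le_integral_norm _).trans ?_
      have hi : Integrable fun x => spaceBump k (x - z.2) :=
        (hm.smooth_space.integrable).comp_sub_right z.2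
      calc ∫ x, ‖spaceBump k (x - z.2) * u₀ x‖ ≤ ∫ x, spaceBump k (x - z.2) * D := by
            refine integral_mono_of_nonneg (Eventually.of_forall fun x => norm_nonneg _)
              (hi.mul_const D) (Eventually.of_forall fun x => ?_)
            simp only [norm_mul, Real.norm_of_nonneg (hm.nonneg_space _)]
            exact mul_le_mul_of_nonneg_left (hD x) (hm.nonneg_space _)
        _ = D := by
            rw [integral_mul_const, integral_sub_right_eq_self, hm.integral_space, one_mul]
    · filter_upwards [hW.ae_mem hμ] with z hz
      have h1 : Tendsto (fun k : ℕ => ∫ t in Ioo 0 T, timeBump k (z.1 - t)) atTop (𝓝 1) := by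
        refine tendsto_const_nhds.congr' ?_
        filter_upwards [(tendsto_natCast_atTop_atTop.atTop_mul_const hz.1).eventually_ge_atTop 2]
          with k hk
        rw [setIntegral_timeBump hT hz.2.le, step_eq_one hk]
      simpa using (h1.mul (tendsto_integral_spaceBump hu₀.continuous z.2)).mul_const (v z)
  rw [hq, integral_withDensityᵥ hv hu₀.continuous.snd'.aestronglyMeasurable fun z => hD z.2]
  have hAr : (A : EReal) = ((A.toReal : ℝ) : EReal) := (EReal.coe_ennreal_toReal hfin).symm
  have hlim : Tendsto (fun k : ℕ => -(A : EReal) + ((∫ z, (∫ t in Ioo 0 T, timeBump k (z.1 - t))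
      * (∫ x, spaceBump k (x - z.2) * u₀ x) * v z ∂μ : ℝ) : EReal)) atTop
      (𝓝 (-(A : EReal) + ((∫ z, u₀ z.2 * v z ∂μ : ℝ) : EReal))) := by
    rw [hAr]
    simp only [← EReal.coe_neg, ← EReal.coe_add]
    exact (continuous_coe_real_ereal.tendsto _).comp (hL.const_add (-A.toReal))
  refine le_of_tendsto hlim ?_
  filter_upwards [eventually_gt_atTop 0] with k hk
  have hm := isMollifier_bump hk
  rw [← hW.integral_mollify hT hm hv hq hu₀]
  refine le_trans ?_ (smoothObjective'_le (hW.smoothCompetitor_mollify hT hm hμ hv hv2 hq))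
  refine add_le_add (EReal.neg_le_neg_iff.2 ?_) le_rfl
  exact EReal.coe_ennreal_le_coe_ennreal_iff.2
    (hW.smoothAction_mollify_le hT hm hμ hv hv2 hq)

lemma bvObjective_le (hT : 0 < T) (hW : BVCompetitor T W q p) {u₀ : UnitAddCircle → ℝ}
    (hu₀ : TorusSmooth u₀) : bvObjective T u₀ W q p ≤ optimalValue T u₀ := by
  rw [← hW.bvObjective'_eq hT hu₀, ← optimalValue'_eq hT hu₀, bvObjective']
  by_cases htop : measureAction ((slab T).toSignedMeasure - p) q = ⊤
  · simp [htop]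
  · have hex : ∃ (μ : Measure (ℝ × UnitAddCircle)) (_ : IsFiniteMeasure μ)
        (v : ℝ × UnitAddCircle → ℝ), μ.toSignedMeasure = (slab T).toSignedMeasure - p ∧
          Integrable v μ ∧ q = μ.withDensityᵥ v := by
      by_contra! hcon
      refine htop ?_
      simp only [measureAction, iInf_eq_top]
      exact fun μ hμ v hv => absurd hv.2.2 (hcon μ hμ v hv.1 hv.2.1)
    obtain ⟨μ, hfin, v, hμ, hv, hq⟩ := hex
    rw [measureAction_eq hμ hv hq] at htop ⊢
    exact hW.le_optimalValue' hT hμ hv hq htop hu₀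

end BVCompetitor

/-! ### Representation of functionals and limits along an ultrafilter -/

/-- A linear functional bounded by the norm of a linear map into a Hilbert space is represented by
a vector of that space, by the theorems of Hahn–Banach and Riesz. -/
lemma exists_forall_eq_inner {E H : Type*} [AddCommGroup E] [Module ℝ E] [NormedAddCommGroup H]
    [InnerProductSpace ℝ H] [CompleteSpace H] (L : E →ₗ[ℝ] ℝ) (S : E →ₗ[ℝ] H) {C : ℝ}
    (hC0 : 0 ≤ C) (hC : ∀ f, |L f| ≤ C * ‖S f‖) :
    ∃ v : H, ‖v‖ ≤ C ∧ ∀ f, L f = inner ℝ v (S f) := by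
  obtain ⟨g, hg⟩ := S.rangeRestrict.exists_rightInverse_of_surjective S.range_rangeRestrict
  have hSg : ∀ y, S (g y) = y := fun y => by
    have := congrArg (fun l => ((l y : LinearMap.range S) : H)) hg
    simpa using this
  let L' : LinearMap.range S →L[ℝ] ℝ := (L ∘ₗ g).mkContinuous C fun y => by
    have := hC (g y)
    rwa [hSg] at this
  obtain ⟨ℓ, hℓ, hn⟩ := exists_extension_norm_eq (LinearMap.range S) L'
  refine ⟨(InnerProductSpace.toDual ℝ H).symm ℓ, ?_, fun f => ?_⟩
  · rw [LinearIsometryEquiv.norm_map, hn]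
    exact LinearMap.mkContinuous_norm_le _ hC0 _
  · rw [InnerProductSpace.toDual_symm_apply]
    have h1 : ℓ (S f) = L (g (S.rangeRestrict f)) := hℓ (S.rangeRestrict f)
    have h2 : |L (f - g (S.rangeRestrict f))| ≤ 0 := by
      refine (hC _).trans (le_of_eq ?_)
      rw [map_sub, hSg]
      simp
    have h3 := abs_eq_zero.1 (le_antisymm h2 (abs_nonneg _))
    rw [map_sub, sub_eq_zero] at h3
    rw [h3, h1]

/-- The case of a space of square-integrable functions. -/
lemma exists_forall_eq_integral_mul {X E : Type*} [MeasurableSpace X] {μ : Measure X}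
    [AddCommGroup E] [Module ℝ E] (L : E →ₗ[ℝ] ℝ) (S : E →ₗ[ℝ] (X → ℝ))
    (hS : ∀ f, MemLp (S f) 2 μ) {C : ℝ} (hC0 : 0 ≤ C)
    (hC : ∀ f, |L f| ≤ C * √(∫ x, S f x ^ 2 ∂μ)) :
    ∃ v : X → ℝ, MemLp v 2 μ ∧ ∫ x, v x ^ 2 ∂μ ≤ C ^ 2 ∧ ∀ f, L f = ∫ x, S f x * v x ∂μ := by
  have hsq : ∀ g : Lp ℝ 2 μ, ∫ x, g x ^ 2 ∂μ = ‖g‖ ^ 2 := fun g => by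
    rw [← real_inner_self_eq_norm_sq, L2.inner_def]
    simp [pow_two]
  let S' : E →ₗ[ℝ] Lp ℝ 2 μ :=
    { toFun := fun f => (hS f).toLp (S f)
      map_add' := fun f g => by
        rw [← MemLp.toLp_add]
        exact MemLp.toLp_congr _ _ (Eventually.of_forall fun x => by simp)
      map_smul' := fun c f => by
        rw [RingHom.id_apply, ← MemLp.toLp_const_smul]
        exact MemLp.toLp_congr _ _ (Eventually.of_forall fun x => by simp) }
  have hn : ∀ f, √(∫ x, S f x ^ 2 ∂μ) = ‖S' f‖ := fun f => by
    rw [← Real.sqrt_sq (norm_nonneg (S' f)), ← hsq]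
    congr 1
    refine integral_congr_ae ?_
    filter_upwards [(hS f).coeFn_toLp] with x hx
    change _ = ((hS f).toLp (S f)) x ^ 2
    rw [hx]
  obtain ⟨v, hv, hv'⟩ := exists_forall_eq_inner L S' hC0 fun f => by
    rw [← hn]
    exact hC f
  refine ⟨v, Lp.memLp v, ?_, fun f => ?_⟩
  · rw [hsq]
    exact pow_le_pow_left₀ (norm_nonneg _) hv 2
  · rw [hv', L2.inner_def]
    refine integral_congr_ae ?_
    filter_upwards [(hS f).coeFn_toLp] with x hx
    change inner ℝ (v x) (((hS f).toLp (S f)) x) = _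
    rw [hx]
    simp

lemma exists_tendsto_ultrafilter {ι : Type*} (𝒰 : Ultrafilter ι) {x : ι → ℝ} {C : ℝ}
    (hx : ∀ n, |x n| ≤ C) : ∃ l, Tendsto x 𝒰 (𝓝 l) := by
  obtain ⟨l, -, hl⟩ := (isCompact_Icc (a := -C) (b := C)).ultrafilter_le_nhds (𝒰.map x) (by
    simp only [le_principal_iff, Ultrafilter.coe_map, mem_map]
    exact univ_mem' fun n => abs_le.1 (hx n))
  exact ⟨l, hl⟩

lemma exists_linearMap_tendsto {ι E : Type*} [AddCommGroup E] [Module ℝ E] (𝒰 : Ultrafilter ι)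
    (ℓ : ι → E →ₗ[ℝ] ℝ) (hℓ : ∀ f, ∃ C, ∀ n, |ℓ n f| ≤ C) :
    ∃ L : E →ₗ[ℝ] ℝ, ∀ f, Tendsto (fun n => ℓ n f) 𝒰 (𝓝 (L f)) := by
  have h : ∀ f, ∃ l, Tendsto (fun n => ℓ n f) 𝒰 (𝓝 l) := fun f =>
    (hℓ f).elim fun C hC => exists_tendsto_ultrafilter 𝒰 hC
  choose L hL using h
  refine ⟨{ toFun := L, map_add' := fun f g => ?_, map_smul' := fun c f => ?_ }, hL⟩
  · refine tendsto_nhds_unique (hL (f + g)) ?_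
    simpa only [map_add] using (hL f).add (hL g)
  · refine tendsto_nhds_unique (hL (c • f)) ?_
    simpa only [map_smul, smul_eq_mul, RingHom.id_apply] using (hL f).const_mul c

/-- Finite measures of bounded mass on a compact set converge weakly along an ultrafilter. -/
lemma exists_measure_tendsto {ι X : Type*} [MeasurableSpace X] [TopologicalSpace X] [T2Space X]
    [BorelSpace X] (𝒰 : Ultrafilter ι) {K : Set X} (hK : IsCompact K) (ρ : ι → Measure X)
    [∀ n, IsFiniteMeasure (ρ n)] {C : ℝ} (hC : ∀ n, (ρ n).real univ ≤ C) (h : ∀ n, ρ n Kᶜ = 0) :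
    ∃ μ : Measure X, IsFiniteMeasure μ ∧ ∀ f : BoundedContinuousFunction X ℝ,
      Tendsto (fun n => ∫ x, f x ∂(ρ n)) 𝒰 (𝓝 (∫ x, f x ∂μ)) := by
  let ρ' : ι → FiniteMeasure X := fun n => ⟨ρ n, inferInstance⟩
  obtain ⟨μ, -, hμ⟩ := (isCompact_setOfPred_finiteMeasure_le_of_isCompact C.toNNReal
    hK).ultrafilter_le_nhds (𝒰.map ρ') (by
      simp only [le_principal_iff, Ultrafilter.coe_map, mem_map]
      refine univ_mem' fun n => ⟨?_, ?_⟩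
      · rw [← NNReal.coe_le_coe]
        exact (hC n).trans (Real.le_coe_toNNReal C)
      · change ((ρ n) Kᶜ).toNNReal = 0
        simp [h n])
  exact ⟨μ, inferInstance, FiniteMeasure.tendsto_iff_forall_integral_tendsto.1 hμ⟩

/-- The Cauchy–Schwarz inequality. -/
lemma sq_integral_mul_le' {X : Type*} [MeasurableSpace X] {μ : Measure X} {f g : X → ℝ}
    (hf : MemLp f 2 μ) (hg : MemLp g 2 μ) :
    (∫ z, f z * g z ∂μ) ^ 2 ≤ (∫ z, g z ^ 2 ∂μ) * ∫ z, f z ^ 2 ∂μ := by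
  have h : ∀ c : ℝ, 0 ≤ (∫ z, f z ^ 2 ∂μ) * (c * c) + (-2 * ∫ z, f z * g z ∂μ) * c
      + ∫ z, g z ^ 2 ∂μ := by
    intro c
    have : 0 ≤ ∫ z, (c * f z - g z) ^ 2 ∂μ := integral_nonneg fun z => sq_nonneg _
    have e : ∀ z, (c * f z - g z) ^ 2
        = (c * c) * f z ^ 2 + (-2 * c) * (f z * g z) + g z ^ 2 := fun z => by ring
    simp_rw [e] at this
    have h1 : Integrable (fun z => f z * g z) μ := hf.integrable_mul hg
    have h3 : Integrable (fun z => c * c * f z ^ 2 + -2 * c * (f z * g z)) μ :=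
      (hf.integrable_sq.const_mul _).add (h1.const_mul _)
    rw [integral_add h3 hg.integrable_sq, integral_add (hf.integrable_sq.const_mul _)
      (h1.const_mul _), integral_const_mul, integral_const_mul] at this
    linarith
  have := discrim_le_zero h
  rw [discrim] at this
  nlinarith

/-! ### Bounds on smooth competitors of finite action -/

namespace SmoothCompetitor

variable {T : ℝ} {W : ℝ → UnitAddCircle → ℝ}

lemma integral_massMeasure_time (hT : 0 < T) (hW : SmoothCompetitor T W) {a : ℝ → ℝ}
    (ha : Continuous a) : ∫ z, a z.1 ∂(massMeasure T W) = ∫ t in Ioo 0 T, a t := by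
  have hc : ContinuousOn (fun z : ℝ × UnitAddCircle => a z.1 * (1 - torusDeriv (W z.1) z.2))
      (Icc 0 T ×ˢ univ) :=
    ha.fst'.continuousOn.mul (continuousOn_const.sub (hW.continuousOn_spaceDeriv hT))
  rw [hW.integral_massMeasure hT, integral_prod _ (integrable_slab_of_continuousOn hc)]
  refine setIntegral_congr_fun measurableSet_Ioo fun t ht => ?_
  have hs := hW.torusSmooth (Ioo_subset_Icc_self ht)
  simp only
  rw [integral_const_mul, integral_sub (integrable_const _) hs.torusDeriv.integrable,
    hs.integral_torusDeriv]
  simp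

lemma massMeasure_real_univ (hT : 0 < T) (hW : SmoothCompetitor T W) :
    (massMeasure T W).real univ = T := by
  have h := hW.integral_massMeasure_time hT (a := fun _ => 1) continuous_const
  simp only [integral_const, smul_eq_mul, mul_one] at h
  rw [h]
  simp [hT.le]

lemma massMeasure_compl (T : ℝ) (W : ℝ → UnitAddCircle → ℝ) :
    massMeasure T W (Icc 0 T ×ˢ univ)ᶜ = 0 := by
  refine withDensity_absolutelyContinuous _ _ ?_
  have := ae_slab_mem T
  rw [ae_iff] at this
  refine measure_mono_null (fun z hz h => hz ⟨Ioo_subset_Icc_self h, mem_univ _⟩) this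

lemma memLp_velocity (hT : 0 < T) (hW : SmoothCompetitor T W) (hA : smoothAction T W ≠ ⊤) :
    MemLp (velocity T W) 2 (massMeasure T W) := by
  have hm := (hW.integrable_velocity hT).1
  refine (memLp_two_iff_integrable_sq hm).2 ?_
  have h1 : Integrable (fun z => velocity T W z ^ 2 / 2) (massMeasure T W) := by
    refine ⟨((hm.aemeasurable.pow_const 2).div_const 2).aestronglyMeasurable,
      (hasFiniteIntegral_iff_ofReal (Eventually.of_forall fun z => by positivity)).2 ?_⟩
    rw [hW.lintegral_velocity hT]
    exact hA.lt_top
  simpa using h1.mul_const 2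

lemma integral_velocity_sq (hT : 0 < T) (hW : SmoothCompetitor T W) (hA : smoothAction T W ≠ ⊤) :
    ∫ z, velocity T W z ^ 2 ∂(massMeasure T W) = 2 * (smoothAction T W).toReal := by
  have h1 : Integrable (fun z => velocity T W z ^ 2 / 2) (massMeasure T W) :=
    (hW.memLp_velocity hT hA).integrable_sq.div_const 2
  rw [← hW.lintegral_velocity hT, ← integral_eq_lintegral_of_nonneg_ae
    (Eventually.of_forall fun z => by positivity) h1.1, integral_div]
  ring

lemma integral_abs_timeDeriv_le (hT : 0 < T) (hW : SmoothCompetitor T W)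
    (hA : smoothAction T W ≠ ⊤) :
    ∫ z : ℝ × UnitAddCircle, |derivWithin (fun s => W s z.2) (Icc 0 T) z.1| ∂(slab T)
      ≤ T / 2 + (smoothAction T W).toReal := by
  have hfin := hW.isFiniteMeasure_massMeasure hT
  have h2 := (hW.memLp_velocity hT hA).integrable_sq
  have e : ∫ z : ℝ × UnitAddCircle, |derivWithin (fun s => W s z.2) (Icc 0 T) z.1| ∂(slab T)
      = ∫ z, |velocity T W z| ∂(massMeasure T W) := by
    rw [hW.integral_massMeasure hT]
    refine integral_congr_ae ?_
    filter_upwards [hW.ae_density_mul_velocity, hW.ae_density_nonneg] with z hz hz'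
    rw [← hz, abs_mul, abs_of_nonneg hz', mul_comm]
  have h3 : ∫ z, |velocity T W z| ∂(massMeasure T W)
      ≤ ∫ z, (1 / 2 + velocity T W z ^ 2 / 2) ∂(massMeasure T W) := by
    refine integral_mono (hW.integrable_velocity hT).abs
      ((integrable_const _).add (h2.div_const 2)) fun z => ?_
    simp only
    nlinarith [sq_nonneg (|velocity T W z| - 1), sq_abs (velocity T W z)]
  rw [e]
  refine h3.trans (le_of_eq ?_)
  rw [integral_add (integrable_const _) (h2.div_const 2), integral_const, integral_div,
    hW.integral_velocity_sq hT hA, hW.massMeasure_real_univ hT, smul_eq_mul]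
  ring

lemma sub_le_one (hW : SmoothCompetitor T W) {t : ℝ} (ht : t ∈ Icc 0 T) (x y : UnitAddCircle) :
    W t y - W t x ≤ 1 := by
  obtain ⟨a, rfl⟩ := isOpenQuotientMap_coe.surjective x
  obtain ⟨b, hb, rfl⟩ : ∃ b ∈ Ico a (a + 1), (b : UnitAddCircle) = y := by
    have : y ∈ ((↑) : ℝ → UnitAddCircle) '' Ico a (a + 1) := by
      rw [AddCircle.coe_image_Ico_eq]
      trivial
    exact this
  have hs := hW.torusSmooth ht
  have h := convex_univ.image_sub_le_mul_sub_of_deriv_le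
    (f := fun x : ℝ => W t (x : UnitAddCircle)) (C := 1) (ContDiff.continuous hs).continuousOn
    (ContDiff.differentiable hs (by simp)).differentiableOn
    (fun x _ => by rw [← torusDeriv_coe]; exact hW.deriv_le t ht x) a (mem_univ _) b (mem_univ _)
    hb.1
  linarith [hb.2]

lemma abs_integral_le (hT : 0 < T) (hW : SmoothCompetitor T W) {t : ℝ} (ht : t ∈ Icc 0 T) :
    |∫ x, W t x|
      ≤ ∫ z : ℝ × UnitAddCircle, |derivWithin (fun s => W s z.2) (Icc 0 T) z.1| ∂(slab T) := by
  have hc := (hW.continuousOn_timeDeriv hT).abs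
  have hi := integrable_slab_of_continuousOn hc
  rw [integral_prod_symm _ hi]
  refine abs_integral_le_integral_abs.trans ?_
  refine integral_mono (hW.torusSmooth ht).integrable.abs hi.integral_prod_right fun x => ?_
  have hmap : ∀ u v, Icc u v ⊆ Icc 0 T → ContinuousOn (fun s =>
      derivWithin (fun s => W s x) (Icc 0 T) s) (Icc u v) := fun u v huv =>
    (hW.continuousOn_timeDeriv hT).comp (f := fun s : ℝ => (s, x)) (by fun_prop)
      fun s hs => ⟨huv hs, mem_univ _⟩
  have hft : ∫ s in t..T, derivWithin (fun s => W s x) (Icc 0 T) s = W T x - W t x := by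
    refine intervalIntegral.integral_eq_sub_of_hasDerivAt_of_le (f := fun s => W s x) ht.2 ?_ ?_ ?_
    · exact (hW.continuousOn hT).comp (f := fun s : ℝ => (s, x)) (by fun_prop)
        fun s hs => ⟨⟨ht.1.trans hs.1, hs.2⟩, mem_univ _⟩
    · intro s hs
      have hs' : s ∈ Ioo 0 T := ⟨lt_of_le_of_lt ht.1 hs.1, hs.2⟩
      exact (hW.hasDerivWithinAt hT (Ioo_subset_Icc_self hs') x).hasDerivAt
        (Icc_mem_nhds hs'.1 hs'.2)
    · exact (hmap t T fun s hs => ⟨ht.1.trans hs.1, hs.2⟩).intervalIntegrable_of_Icc ht.2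
  have e : |W t x| = |∫ s in t..T, derivWithin (fun s => W s x) (Icc 0 T) s| := by
    rw [hft, hW.final, zero_sub, abs_neg]
  simp only
  rw [e]
  refine (intervalIntegral.abs_integral_le_integral_abs ht.2).trans ?_
  rw [intervalIntegral.integral_of_le ht.2, integral_Ioc_eq_integral_Ioo]
  refine setIntegral_mono_set ?_ (Eventually.of_forall fun s => abs_nonneg _)
    (Ioo_subset_Ioo_left ht.1).eventuallyLE
  exact ((hmap 0 T subset_rfl).abs.integrableOn_compact isCompact_Icc).mono_set Ioo_subset_Icc_self

/-- Uniform bound: the oscillation in space is at most `1` because `∂ₓW ≤ 1`, and the mean is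
controlled by the action. -/
lemma abs_le (hT : 0 < T) (hW : SmoothCompetitor T W) (hA : smoothAction T W ≠ ⊤) {t : ℝ}
    (ht : t ∈ Icc 0 T) (x : UnitAddCircle) :
    |W t x| ≤ 1 + T / 2 + (smoothAction T W).toReal := by
  have h1 := (hW.abs_integral_le hT ht).trans (hW.integral_abs_timeDeriv_le hT hA)
  have hi := (hW.torusSmooth ht).integrable
  have h2 : W t x - 1 ≤ ∫ y, W t y := by
    have := integral_mono (μ := (volume : Measure UnitAddCircle)) (integrable_const (W t x - 1)) hi
      fun y => by linarith [hW.sub_le_one ht y x]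
    simpa using this
  have h3 : ∫ y, W t y ≤ W t x + 1 := by
    have := integral_mono (μ := (volume : Measure UnitAddCircle)) hi (integrable_const (W t x + 1))
      fun y => by linarith [hW.sub_le_one ht x y]
    simpa using this
  rw [_root_.abs_le] at h1 ⊢
  constructor <;> linarith [h1.1, h1.2]

/-- The identity for time derivatives of generalized competitors, in terms of mass and velocity. -/
lemma integral_massMeasure_velocity_mul (hT : 0 < T) (hW : SmoothCompetitor T W) {a : ℝ → ℝ}
    (ha : ContDiff ℝ ∞ a) {C : ℝ} (hC : ∀ t, |a t| ≤ C) {b : UnitAddCircle → ℝ}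
    (hb : TorusSmooth b) :
    ∫ z, a z.1 * b z.2 * velocity T W z ∂(massMeasure T W)
      = -(∫ z : ℝ × UnitAddCircle, deriv a z.1 * b z.2 * W z.1 z.2 ∂(slab T))
        - a 0 * ∫ x, W 0 x * b x := by
  obtain ⟨D, -, hD⟩ := hb.exists_bound
  have hC0 : 0 ≤ C := (abs_nonneg _).trans (hC 0)
  rw [← (hW.bvCompetitor hT).integral_timeDeriv hT ha hb, hW.withDensityᵥ_timeDeriv hT,
    integral_withDensityᵥ (C := C * D) (hW.integrable_velocity hT)]
  · exact (ha.continuous.fst'.mul hb.continuous.snd').aestronglyMeasurable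
  · intro z
    rw [abs_mul]
    exact mul_le_mul (hC _) (hD _) (abs_nonneg _) hC0

end SmoothCompetitor

/-! ### Weak limits -/

section WeakLimits

variable {ι X : Type*} [MeasurableSpace X] (𝒰 : Ultrafilter ι)

/-- Momenta `vₙ ρₙ` with bounded `∫ vₙ² dρₙ` converge weakly to some `v μ` when `ρₙ` converges to
`μ`, with lower semicontinuity of `∫ v² dρ`: the limit functional is bounded by the norm of
`L²(μ)`. -/
lemma exists_momentum_limit [TopologicalSpace X] [BorelSpace X] {ρ : ι → Measure X}
    [∀ n, IsFiniteMeasure (ρ n)] {μ : Measure X} [IsFiniteMeasure μ]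
    (hρ : ∀ f : BoundedContinuousFunction X ℝ,
      Tendsto (fun n => ∫ x, f x ∂(ρ n)) 𝒰 (𝓝 (∫ x, f x ∂μ)))
    {m : ℝ} (hm : ∀ n, (ρ n).real univ ≤ m) {v : ι → X → ℝ} (hv : ∀ n, MemLp (v n) 2 (ρ n))
    {M : ℝ} (hM : ∀ n, ∫ x, v n x ^ 2 ∂(ρ n) ≤ M) {B : ℝ}
    (hB : Tendsto (fun n => ∫ x, v n x ^ 2 ∂(ρ n)) 𝒰 (𝓝 B)) :
    ∃ w : X → ℝ, MemLp w 2 μ ∧ ∫ x, w x ^ 2 ∂μ ≤ B ∧ ∀ f : BoundedContinuousFunction X ℝ,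
      Tendsto (fun n => ∫ x, f x * v n x ∂(ρ n)) 𝒰 (𝓝 (∫ x, f x * w x ∂μ)) := by
  have hf2 : ∀ (f : BoundedContinuousFunction X ℝ) (ν : Measure X) [IsFiniteMeasure ν],
      MemLp f 2 ν := fun f ν _ =>
    MemLp.of_bound f.continuous.aestronglyMeasurable ‖f‖ (Eventually.of_forall f.norm_coe_le_norm)
  have hint : ∀ n (f : BoundedContinuousFunction X ℝ), Integrable (fun x => f x * v n x) (ρ n) :=
    fun n f => (hf2 f (ρ n)).integrable_mul (hv n)
  let ℓ : ι → BoundedContinuousFunction X ℝ →ₗ[ℝ] ℝ := fun n =>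
    { toFun := fun f => ∫ x, f x * v n x ∂(ρ n)
      map_add' := fun f g => by
        rw [← integral_add (hint n f) (hint n g)]
        simp [add_mul]
      map_smul' := fun c f => by
        rw [RingHom.id_apply, smul_eq_mul, ← integral_const_mul]
        simp [mul_assoc] }
  have hcs : ∀ n f, ℓ n f ^ 2 ≤ (∫ x, v n x ^ 2 ∂(ρ n)) * ∫ x, f x ^ 2 ∂(ρ n) := fun n f =>
    sq_integral_mul_le' (hf2 f (ρ n)) (hv n)
  have hB0 : 0 ≤ B := ge_of_tendsto hB (Eventually.of_forall fun n =>
    integral_nonneg fun x => sq_nonneg _)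
  obtain ⟨L, hL⟩ := exists_linearMap_tendsto 𝒰 ℓ fun f => by
    refine ⟨√(M * (m * ‖f‖ ^ 2)), fun n => Real.abs_le_sqrt ((hcs n f).trans ?_)⟩
    have h0 : 0 ≤ ∫ x, v n x ^ 2 ∂(ρ n) := integral_nonneg fun x => sq_nonneg _
    refine mul_le_mul (hM n) ?_ (integral_nonneg fun x => sq_nonneg _) (h0.trans (hM n))
    calc ∫ x, f x ^ 2 ∂(ρ n) ≤ ∫ _, ‖f‖ ^ 2 ∂(ρ n) := by
          refine integral_mono (hf2 f (ρ n)).integrable_sq (integrable_const _) fun x => ?_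
          simp only
          rw [← sq_abs (f x)]
          exact pow_le_pow_left₀ (abs_nonneg _) (f.norm_coe_le_norm x) 2
      _ ≤ m * ‖f‖ ^ 2 := by
          rw [integral_const, smul_eq_mul]
          exact mul_le_mul_of_nonneg_right (hm n) (by positivity)
  have hLB : ∀ f, L f ^ 2 ≤ B * ∫ x, f x ^ 2 ∂μ := fun f => by
    have h1 := hρ (f * f)
    simp only [← pow_two] at h1
    exact le_of_tendsto_of_tendsto ((hL f).pow 2) (hB.mul h1)
      (Eventually.of_forall fun n => hcs n f)
  let S : BoundedContinuousFunction X ℝ →ₗ[ℝ] (X → ℝ) :=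
    { toFun := fun f => f, map_add' := fun f g => rfl, map_smul' := fun c f => rfl }
  obtain ⟨w, hw, hwB, hwL⟩ := exists_forall_eq_integral_mul L S (fun f => hf2 f μ)
    (Real.sqrt_nonneg B) fun f => by
      rw [← Real.sqrt_mul hB0]
      exact Real.abs_le_sqrt (hLB f)
  rw [Real.sq_sqrt hB0] at hwB
  refine ⟨w, hw, hwB, fun f => ?_⟩
  have := hL f
  rw [hwL f] at this
  exact this

/-- Uniformly bounded functions converge weakly in `L²`, to a function with the same bound. -/
lemma exists_bounded_limit {μ : Measure X} [IsFiniteMeasure μ] {w : ι → X → ℝ}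
    (hw : ∀ n, AEStronglyMeasurable (w n) μ) {C : ℝ} (hC : ∀ n, ∀ᵐ x ∂μ, |w n x| ≤ C) :
    ∃ V : X → ℝ, MemLp V 2 μ ∧ (∀ᵐ x ∂μ, |V x| ≤ C) ∧ ∀ f : X → ℝ, MemLp f 2 μ →
      Tendsto (fun n => ∫ x, f x * w n x ∂μ) 𝒰 (𝓝 (∫ x, f x * V x ∂μ)) := by
  have hw2 : ∀ n, MemLp (w n) 2 μ := fun n => MemLp.of_bound (hw n) C (hC n)
  let E : Submodule ℝ (X → ℝ) :=
    { carrier := {f | MemLp f 2 μ}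
      add_mem' := fun hf hg => hf.add hg
      zero_mem' := MemLp.zero
      smul_mem' := fun c f hf => hf.const_smul c }
  let ℓ : ι → E →ₗ[ℝ] ℝ := fun n =>
    { toFun := fun f => ∫ x, f.1 x * w n x ∂μ
      map_add' := fun f g => by
        have h1 : Integrable (fun x => f.1 x * w n x) μ := MemLp.integrable_mul f.2 (hw2 n)
        have h2 : Integrable (fun x => g.1 x * w n x) μ := MemLp.integrable_mul g.2 (hw2 n)
        rw [← integral_add h1 h2]
        simp [add_mul]
      map_smul' := fun c f => by
        rw [RingHom.id_apply, smul_eq_mul, ← integral_const_mul]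
        simp [mul_assoc] }
  set B : ℝ := C ^ 2 * μ.real univ with hB
  have hB0 : 0 ≤ B := by positivity
  have hwB : ∀ n, ∫ x, w n x ^ 2 ∂μ ≤ B := fun n => by
    calc ∫ x, w n x ^ 2 ∂μ ≤ ∫ _, C ^ 2 ∂μ := by
          refine integral_mono_ae (hw2 n).integrable_sq (integrable_const _) ?_
          filter_upwards [hC n] with x hx
          rw [← sq_abs (w n x)]
          exact pow_le_pow_left₀ (abs_nonneg _) hx 2
      _ = B := by rw [integral_const, smul_eq_mul, mul_comm]
  have hcs : ∀ n (f : E), |ℓ n f| ≤ √B * √(∫ x, f.1 x ^ 2 ∂μ) := fun n f => by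
    rw [← Real.sqrt_mul hB0]
    refine Real.abs_le_sqrt ((sq_integral_mul_le' f.2 (hw2 n)).trans ?_)
    exact mul_le_mul_of_nonneg_right (hwB n) (integral_nonneg fun x => sq_nonneg _)
  obtain ⟨L, hL⟩ := exists_linearMap_tendsto 𝒰 ℓ fun f => ⟨_, fun n => hcs n f⟩
  obtain ⟨V, hV, -, hVL⟩ := exists_forall_eq_integral_mul L E.subtype (fun f => f.2)
    (Real.sqrt_nonneg B) fun f => le_of_tendsto (hL f).abs (Eventually.of_forall fun n => hcs n f)
  have hlim : ∀ f : X → ℝ, MemLp f 2 μ →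
      Tendsto (fun n => ∫ x, f x * w n x ∂μ) 𝒰 (𝓝 (∫ x, f x * V x ∂μ)) := fun f hf => by
    have := hL ⟨f, hf⟩
    rw [hVL ⟨f, hf⟩] at this
    exact this
  refine ⟨V, hV, ?_, hlim⟩
  have hV1 : Integrable V μ := hV.integrable one_le_two
  have hset : ∀ s, MeasurableSet s →
      Tendsto (fun n => ∫ x in s, w n x ∂μ) 𝒰 (𝓝 (∫ x in s, V x ∂μ)) := fun s hs => by
    have h := hlim (s.indicator 1) ((memLp_const (1 : ℝ)).indicator hs)
    have e : ∀ g : X → ℝ, ∫ x, s.indicator 1 x * g x ∂μ = ∫ x in s, g x ∂μ := fun g => by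
      rw [← integral_indicator hs]
      refine integral_congr_ae (Eventually.of_forall fun x => ?_)
      by_cases hx : x ∈ s <;> simp [hx]
    simpa only [e] using h
  have h1 : V ≤ᵐ[μ] fun _ => C := by
    refine ae_le_of_forall_setIntegral_le hV1 (integrable_const _) fun s hs _ => ?_
    refine le_of_tendsto (hset s hs) (Eventually.of_forall fun n => ?_)
    refine integral_mono_ae ((hw2 n).integrable one_le_two).integrableOn (integrable_const _) ?_
    filter_upwards [ae_restrict_of_ae (hC n)] with x hx using (abs_le.1 hx).2
  have h2 : (fun _ => -C) ≤ᵐ[μ] V := by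
    refine ae_le_of_forall_setIntegral_le (integrable_const _) hV1 fun s hs _ => ?_
    refine ge_of_tendsto (hset s hs) (Eventually.of_forall fun n => ?_)
    refine integral_mono_ae (integrable_const _) ((hw2 n).integrable one_le_two).integrableOn ?_
    filter_upwards [ae_restrict_of_ae (hC n)] with x hx using (abs_le.1 hx).1
  filter_upwards [h1, h2] with x hx1 hx2 using abs_le.2 ⟨hx2, hx1⟩

end WeakLimits

/-! ### Limits of smooth competitors -/

/-- What survives in a weak limit of smooth competitors with bounded action: a mass measure `ρ`, a
velocity `v` and a bounded function `V`, subject to `∂ₓV = 1 - ρ` and `∂ₜV = vρ`. The last field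
contains in addition the condition `V(T,·) = 0`. -/
structure IsWeakCompetitor (T : ℝ) (ρ : Measure (ℝ × UnitAddCircle)) (v V : ℝ × UnitAddCircle → ℝ)
    (C : ℝ) : Prop where
  map_fst : ρ.map Prod.fst = volume.restrict (Ioo 0 T)
  memLp : MemLp v 2 ρ
  memLp_potential : MemLp V 2 (slab T)
  bound : ∀ᵐ z ∂(slab T), |V z| ≤ C
  space : ∀ φ, IsTestFunction T φ → ∫ z, φ z ∂(slab T) - ∫ z, φ z ∂ρ
    = -∫ z, V z * torusDeriv (fun y => φ (z.1, y)) z.2 ∂(slab T)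
  time : ∀ φ, IsTestFunction T φ → ∫ z, φ z * v z ∂ρ
    = -∫ z, V z * deriv (fun s => φ (s, z.2)) z.1 ∂(slab T)
  primitive : ∀ α : ℝ → ℝ, ContDiff ℝ ∞ α → HasCompactSupport α → ∀ b, TorusSmooth b →
    ∫ z, (∫ t in (0 : ℝ)..z.1, α t) * b z.2 * v z ∂ρ = -∫ z, α z.1 * b z.2 * V z ∂(slab T)

lemma memLp_slab_of_continuous {T : ℝ} {f : ℝ × UnitAddCircle → ℝ} (hf : Continuous f) :
    MemLp f 2 (slab T) := by
  obtain ⟨C, -, hC⟩ := exists_bound_of_continuousOn (T := T) hf.continuousOn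
  refine MemLp.of_bound hf.aestronglyMeasurable C ?_
  filter_upwards [ae_slab_mem T] with z hz using hC z.1 (Ioo_subset_Icc_self hz) z.2

/-- Compactness: smooth competitors with bounded action have a weak limit along any ultrafilter, and
the action is lower semicontinuous. -/
lemma exists_weakCompetitor {ι : Type*} {T : ℝ} (hT : 0 < T) (𝒰 : Ultrafilter ι)
    {W : ι → ℝ → UnitAddCircle → ℝ} (hW : ∀ n, SmoothCompetitor T (W n))
    (hfin : ∀ n, smoothAction T (W n) ≠ ⊤) {M : ℝ} (hM : ∀ n, (smoothAction T (W n)).toReal ≤ M) :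
    ∃ (ρ : Measure (ℝ × UnitAddCircle)) (_ : IsFiniteMeasure ρ) (v V : ℝ × UnitAddCircle → ℝ)
      (C A : ℝ), IsWeakCompetitor T ρ v V C ∧
        Tendsto (fun n => (smoothAction T (W n)).toReal) 𝒰 (𝓝 A) ∧ ∫ z, v z ^ 2 / 2 ∂ρ ≤ A ∧
        ∀ f : BoundedContinuousFunction (ℝ × UnitAddCircle) ℝ, Tendsto (fun n =>
          ∫ z : ℝ × UnitAddCircle, f z * derivWithin (fun s => W n s z.2) (Icc 0 T) z.1 ∂(slab T)) 𝒰
          (𝓝 (∫ z, f z * v z ∂ρ)) := by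
  have := fun n => (hW n).isFiniteMeasure_massMeasure hT
  obtain ⟨ρ, hρfin, hρ⟩ := exists_measure_tendsto 𝒰 (isCompact_Icc_prod T)
    (fun n => massMeasure T (W n)) (C := T) (fun n => ((hW n).massMeasure_real_univ hT).le)
    fun n => SmoothCompetitor.massMeasure_compl T (W n)
  obtain ⟨A, hA⟩ := exists_tendsto_ultrafilter 𝒰 (x := fun n => (smoothAction T (W n)).toReal)
    fun n => by rw [abs_of_nonneg ENNReal.toReal_nonneg]; exact hM n
  obtain ⟨v, hv, hvA, hvlim⟩ := exists_momentum_limit 𝒰 hρ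
    (fun n => ((hW n).massMeasure_real_univ hT).le) (fun n => (hW n).memLp_velocity hT (hfin n))
    (M := 2 * M) (fun n => by
      rw [(hW n).integral_velocity_sq hT (hfin n)]
      linarith [hM n]) (B := 2 * A) (by
      simp only [fun n => (hW n).integral_velocity_sq hT (hfin n)]
      exact hA.const_mul 2)
  obtain ⟨V, hV, hVC, hVlim⟩ := exists_bounded_limit 𝒰 (μ := slab T)
    (w := fun n z => W n z.1 z.2) (C := 1 + T / 2 + M)
    (fun n => (integrable_slab_of_continuousOn ((hW n).continuousOn hT)).1) (fun n => by
      filter_upwards [ae_slab_mem T] with z hz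
      linarith [(hW n).abs_le hT (hfin n) (Ioo_subset_Icc_self hz) z.2, hM n])
  have hvlim' : ∀ f : BoundedContinuousFunction (ℝ × UnitAddCircle) ℝ, Tendsto (fun n =>
      ∫ z : ℝ × UnitAddCircle, f z * derivWithin (fun s => W n s z.2) (Icc 0 T) z.1 ∂(slab T)) 𝒰
      (𝓝 (∫ z, f z * v z ∂ρ)) := fun f => by
    simpa only [fun n => (hW n).integral_massMeasure_velocity hT f] using hvlim f
  refine ⟨ρ, hρfin, v, V, 1 + T / 2 + M, A, ⟨?_, hv, hV, hVC, fun φ hφ => ?_, fun φ hφ => ?_,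
    fun α hα hαc b hb => ?_⟩, hA, ?_, hvlim'⟩
  · refine ext_of_forall_integral_eq_of_IsFiniteMeasure fun a => ?_
    rw [integral_map measurable_fst.aemeasurable a.continuous.aestronglyMeasurable]
    have h := hρ (a.compContinuous ⟨Prod.fst, continuous_fst⟩)
    simp only [BoundedContinuousFunction.compContinuous_apply, ContinuousMap.coe_mk,
      fun n => (hW n).integral_massMeasure_time hT a.continuous] at h
    exact tendsto_nhds_unique h tendsto_const_nhds
  · have hφc := continuous_of_contDiff_lift hφ.smooth
    obtain ⟨D, hD⟩ := hφc.bounded_above_of_compact_support hφ.compact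
    have h1 := hρ (BoundedContinuousFunction.ofNormedAddCommGroup φ hφc D hD)
    simp only [BoundedContinuousFunction.coe_ofNormedAddCommGroup] at h1
    have h2 := hVlim _ (memLp_slab_of_continuous (T := T) (continuous_torusDeriv hφ.smooth))
    refine tendsto_nhds_unique (h1.const_sub (∫ z, φ z ∂(slab T))) ?_
    simp only [mul_comm (V _)]
    refine h2.neg.congr fun n => ?_
    simp only [mul_comm _ (W n _ _)]
    rw [← (hW n).integral_spaceDeriv_mul hT hφ, (hW n).integral_massMeasure hT]
    simp only [mul_sub, mul_one]
    have h3 : Integrable (fun z => φ z * torusDeriv (W n z.1) z.2) (slab T) :=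
      integrable_slab_of_continuousOn (hφc.continuousOn.mul ((hW n).continuousOn_spaceDeriv hT))
    rw [integral_sub (integrable_slab_of_continuousOn hφc.continuousOn) h3, sub_sub_cancel]
  · have hφc := continuous_of_contDiff_lift hφ.smooth
    obtain ⟨D, hD⟩ := hφc.bounded_above_of_compact_support hφ.compact
    have h1 := hvlim' (BoundedContinuousFunction.ofNormedAddCommGroup φ hφc D hD)
    simp only [BoundedContinuousFunction.coe_ofNormedAddCommGroup] at h1
    have h2 := hVlim _ (memLp_slab_of_continuous (T := T) (continuous_time_deriv hφ.smooth))
    refine tendsto_nhds_unique h1 ?_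
    simp only [mul_comm (V _)]
    refine h2.neg.congr fun n => ?_
    simp only [mul_comm _ (W n _ _)]
    rw [(hW n).integral_timeDeriv_mul hT hφ]
  · set a : ℝ → ℝ := fun s => ∫ t in (0 : ℝ)..s, α t with ha
    have hda : ∀ s, HasDerivAt a (α s) s := fun s =>
      hα.continuous.integral_hasStrictDerivAt 0 s |>.hasDerivAt
    have hda' : deriv a = α := funext fun s => (hda s).deriv
    have hac : ContDiff ℝ ∞ a :=
      contDiff_infty_iff_deriv.2 ⟨fun s => (hda s).differentiableAt, hda' ▸ hα⟩
    have hab : ∀ s, |a s| ≤ ∫ t, |α t| := fun s => by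
      refine (intervalIntegral.norm_integral_le_integral_norm_uIoc (f := α)).trans ?_
      exact setIntegral_le_integral (hα.continuous.integrable_of_hasCompactSupport hαc).norm
        (Eventually.of_forall fun t => norm_nonneg _)
    obtain ⟨D, -, hD⟩ := hb.exists_bound
    have hI0 : 0 ≤ ∫ t, |α t| := integral_nonneg fun t => abs_nonneg _
    have h1 := hvlim (BoundedContinuousFunction.ofNormedAddCommGroup
      (fun z : ℝ × UnitAddCircle => a z.1 * b z.2)
      (hac.continuous.fst'.mul hb.continuous.snd') ((∫ t, |α t|) * D) fun z => by
        rw [norm_mul]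
        exact mul_le_mul (hab _) (hD _) (abs_nonneg _) hI0)
    simp only [BoundedContinuousFunction.coe_ofNormedAddCommGroup,
      fun n => (hW n).integral_massMeasure_velocity_mul hT hac hab hb] at h1
    have h2 := hVlim _ (memLp_slab_of_continuous (T := T)
      (hα.continuous.fst'.mul hb.continuous.snd'))
    refine tendsto_nhds_unique h1 (h2.neg.congr fun n => ?_)
    have ha0 : a 0 = 0 := intervalIntegral.integral_same
    simp [ha0, hda']
  · rw [integral_div]
    linarith

/-! ### Time slices of a weak limit -/

lemma torusSmooth_zero : TorusSmooth 0 :=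
  contDiff_const (c := (0 : ℝ))

lemma TorusSmooth.add {f g : UnitAddCircle → ℝ} (hf : TorusSmooth f) (hg : TorusSmooth g) :
    TorusSmooth (f + g) :=
  ContDiff.add (𝕜 := ℝ) (n := ∞) hf hg

lemma TorusSmooth.smul (c : ℝ) {f : UnitAddCircle → ℝ} (hf : TorusSmooth f) :
    TorusSmooth (c • f) :=
  ContDiff.const_smul (𝕜 := ℝ) (n := ∞) c hf

lemma continuous_integral_comp_mul {X : Type*} [MeasurableSpace X] {μ : Measure X}
    {π : X → UnitAddCircle} (hπ : Measurable π) {g : X → ℝ} (hg : Integrable g μ) :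
    Continuous fun b : C(UnitAddCircle, ℝ) => ∫ x, b (π x) * g x ∂μ := by
  have hi : ∀ b : C(UnitAddCircle, ℝ), Integrable (fun x => b (π x) * g x) μ := fun b =>
    hg.bdd_mul (c := ‖b‖) (b.continuous.measurable.comp hπ).aestronglyMeasurable
      (Eventually.of_forall fun x => b.norm_coe_le_norm (π x))
  refine LipschitzWith.continuous (K := ⟨∫ x, ‖g x‖ ∂μ, integral_nonneg fun x => norm_nonneg _⟩)
    (LipschitzWith.of_dist_le_mul fun b c => ?_)
  rw [dist_eq_norm, ← integral_sub (hi b) (hi c), dist_eq_norm]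
  refine (norm_integral_le_integral_norm _).trans ?_
  change _ ≤ (∫ x, ‖g x‖ ∂μ) * ‖b - c‖
  rw [← integral_mul_const]
  refine integral_mono_of_nonneg (Eventually.of_forall fun x => norm_nonneg _)
    (hg.norm.mul_const _) (Eventually.of_forall fun x => ?_)
  simp only
  rw [← sub_mul, norm_mul, mul_comm]
  exact mul_le_mul_of_nonneg_left ((b - c).norm_coe_le_norm (π x)) (norm_nonneg _)

lemma le_of_ae_le_of_continuous {T : ℝ} (hT : 0 < T) {g : ℝ → ℝ} (hg : Continuous g) {c : ℝ}
    (h : ∀ᵐ t ∂(volume.restrict (Ioo 0 T)), g t ≤ c) {t : ℝ} (ht : t ∈ Icc 0 T) : g t ≤ c := by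
  have h1 : (fun t => max (g t) c) =ᵐ[volume.restrict (Icc 0 T)] fun _ => c := by
    rw [← restrict_Ioo_eq_restrict_Icc]
    filter_upwards [h] with t ht using max_eq_right ht
  have h2 := Measure.eqOn_Icc_of_ae_eq volume hT.ne h1 (hg.max continuous_const).continuousOn
    continuousOn_const ht
  exact max_eq_right_iff.1 h2

/-- The pairing `-∫_{s > t} b v dρ` of the slice at time `t` with `b`: the value that integration of
`∂ₜW = vρ` from `t` to `T` prescribes, given that `W(T,·) = 0`. -/
noncomputable def slicePairing (ρ : Measure (ℝ × UnitAddCircle)) (v : ℝ × UnitAddCircle → ℝ)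
    (b : UnitAddCircle → ℝ) (t : ℝ) : ℝ :=
  -∫ z, (if t < z.1 then (1 : ℝ) else 0) * (b z.2 * v z) ∂ρ

namespace IsWeakCompetitor

variable {T C : ℝ} {ρ : Measure (ℝ × UnitAddCircle)} {v V : ℝ × UnitAddCircle → ℝ}

lemma ae_mem (h : IsWeakCompetitor T ρ v V C) : ∀ᵐ z ∂ρ, z.1 ∈ Ioo 0 T := by
  refine ae_of_ae_map measurable_fst.aemeasurable ?_
  rw [h.map_fst]
  exact ae_restrict_mem measurableSet_Ioo

lemma ae_ne (h : IsWeakCompetitor T ρ v V C) (t : ℝ) : ∀ᵐ z ∂ρ, z.1 ≠ t := by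
  refine ae_of_ae_map (p := fun s => s ≠ t) measurable_fst.aemeasurable ?_
  rw [h.map_fst]
  refine ae_restrict_of_ae ?_
  simp [ae_iff]

lemma integrable_potential (h : IsWeakCompetitor T ρ v V C) : Integrable V (slab T) :=
  h.memLp_potential.integrable one_le_two

lemma integrable_potential_mul (h : IsWeakCompetitor T ρ v V C) {a : ℝ → ℝ} (ha : Continuous a)
    {b : UnitAddCircle → ℝ} (hb : TorusSmooth b) :
    Integrable (fun z : ℝ × UnitAddCircle => a z.1 * (V z * b z.2)) (slab T) := by
  have h1 := (memLp_slab_of_continuous (T := T) (ha.fst'.mul hb.continuous.snd')).integrable_mul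
    h.memLp_potential
  refine h1.congr (Eventually.of_forall fun z => ?_)
  simp only [Pi.mul_apply]
  ring

lemma ae_bound (h : IsWeakCompetitor T ρ v V C) :
    ∀ᵐ t ∂(volume.restrict (Ioo 0 T)), ∀ᵐ x, |V (t, x)| ≤ C :=
  Measure.ae_ae_of_ae_prod h.bound

lemma slicePairing_final (h : IsWeakCompetitor T ρ v V C) (b : UnitAddCircle → ℝ) :
    slicePairing ρ v b T = 0 := by
  rw [slicePairing, neg_eq_zero]
  refine integral_eq_zero_of_ae ?_
  filter_upwards [h.ae_mem] with z hz
  simp [not_lt.2 hz.2.le]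

variable [IsFiniteMeasure ρ]

lemma integrable_velocity (h : IsWeakCompetitor T ρ v V C) : Integrable v ρ :=
  h.memLp.integrable one_le_two

lemma integrable_mul (h : IsWeakCompetitor T ρ v V C) {b : UnitAddCircle → ℝ}
    (hb : TorusSmooth b) : Integrable (fun z : ℝ × UnitAddCircle => b z.2 * v z) ρ := by
  obtain ⟨D, -, hD⟩ := hb.exists_bound
  exact h.integrable_velocity.bdd_mul (c := D) hb.continuous.snd'.aestronglyMeasurable
    (Eventually.of_forall fun z => hD z.2)

lemma measurable_after (t : ℝ) :
    Measurable fun z : ℝ × UnitAddCircle => if t < z.1 then (1 : ℝ) else 0 :=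
  Measurable.ite (measurableSet_lt measurable_const measurable_fst) measurable_const
    measurable_const

lemma norm_ite_le (p : Prop) [Decidable p] : ‖if p then (1 : ℝ) else 0‖ ≤ 1 := by
  split_ifs <;> simp

lemma integrable_after_mul (h : IsWeakCompetitor T ρ v V C) {b : UnitAddCircle → ℝ}
    (hb : TorusSmooth b) (t : ℝ) : Integrable
      (fun z : ℝ × UnitAddCircle => (if t < z.1 then (1 : ℝ) else 0) * (b z.2 * v z)) ρ :=
  (h.integrable_mul hb).bdd_mul (c := 1) (measurable_after t).aestronglyMeasurable
    (Eventually.of_forall fun _ => norm_ite_le _)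

/-- Slices depend continuously on time, since `ρ` does not charge single times. -/
lemma continuous_slicePairing (h : IsWeakCompetitor T ρ v V C) {b : UnitAddCircle → ℝ}
    (hb : TorusSmooth b) : Continuous (slicePairing ρ v b) := by
  refine Continuous.neg (continuous_iff_continuousAt.2 fun t => ?_)
  refine continuousAt_of_dominated (bound := fun z => ‖b z.2 * v z‖)
    (Eventually.of_forall fun t => (h.integrable_after_mul hb t).1)
    (Eventually.of_forall fun t => Eventually.of_forall fun z => ?_) (h.integrable_mul hb).norm ?_
  · rw [norm_mul]
    exact mul_le_of_le_one_left (norm_nonneg _) (norm_ite_le _)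
  · filter_upwards [h.ae_ne t] with z hz
    refine ContinuousAt.mul ?_ continuousAt_const
    rcases lt_or_gt_of_ne hz with hlt | hgt
    · refine (continuousAt_const (y := (0 : ℝ))).congr ?_
      filter_upwards [Ioi_mem_nhds hlt] with s hs
      rw [if_neg (not_lt.2 (le_of_lt hs))]
    · refine (continuousAt_const (y := (1 : ℝ))).congr ?_
      filter_upwards [Iio_mem_nhds hgt] with s hs
      rw [if_pos (mem_Iio.1 hs)]

/-- For almost every time, the slice of `V` has the prescribed pairing with a given function. -/
lemma ae_slice_eq (h : IsWeakCompetitor T ρ v V C) {b : UnitAddCircle → ℝ} (hb : TorusSmooth b) :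
    ∀ᵐ t ∂(volume.restrict (Ioo 0 T)), ∫ x, V (t, x) * b x = slicePairing ρ v b t := by
  have hVb : Integrable (fun z : ℝ × UnitAddCircle => V z * b z.2) (slab T) := by
    simpa using h.integrable_potential_mul (a := fun _ => 1) continuous_const hb
  have hi1 : Integrable (fun t => ∫ x, V (t, x) * b x) (volume.restrict (Ioo 0 T)) :=
    hVb.integral_prod_left
  have hDc := h.continuous_slicePairing hb
  have hi2 : Integrable (slicePairing ρ v b) (volume.restrict (Ioo 0 T)) :=
    (hDc.integrableOn_Icc (a := 0) (b := T)).mono_set Ioo_subset_Icc_self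
  have key := ae_eq_zero_of_integral_contDiff_smul_eq_zero (hi1.sub hi2).locallyIntegrable
    fun α hα hαc => ?_
  · filter_upwards [key] with t ht
    exact sub_eq_zero.1 ht
  · obtain ⟨A, hA⟩ := hα.continuous.bounded_above_of_compact_support hαc
    have e1 : ∫ t in Ioo 0 T, α t * ∫ x, V (t, x) * b x
        = ∫ z : ℝ × UnitAddCircle, α z.1 * b z.2 * V z ∂(slab T) := by
      have := integral_prod _ (h.integrable_potential_mul hα.continuous hb)
      simp only [integral_const_mul] at this
      rw [← this]
      refine integral_congr_ae (Eventually.of_forall fun z => ?_)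
      simp only
      ring
    have e2 : ∫ t in Ioo 0 T, α t * slicePairing ρ v b t
        = ∫ z : ℝ × UnitAddCircle, α z.1 * b z.2 * V z ∂(slab T) := by
      have e3 : ∀ t, α t * slicePairing ρ v b t = -∫ z,
          (α t * (if t < z.1 then (1 : ℝ) else 0)) * (b z.2 * v z) ∂ρ := fun t => by
        rw [slicePairing, mul_neg, ← integral_const_mul]
        simp only [mul_assoc]
      simp only [e3]
      rw [integral_neg, integral_integral_swap, ← neg_eq_iff_eq_neg.2 (h.primitive α hα hαc b hb)]
      · congr 1
        refine integral_congr_ae ?_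
        filter_upwards [h.ae_mem] with z hz
        rw [integral_mul_const, ← mul_assoc]
        congr 2
        have e4 : ∀ t, α t * (if t < z.1 then (1 : ℝ) else 0) = (Iio z.1).indicator α t :=
          fun t => by
            by_cases ht : t < z.1 <;> simp [ht]
        simp only [e4]
        rw [setIntegral_indicator measurableSet_Iio, intervalIntegral.integral_of_le hz.1.le,
          integral_Ioc_eq_integral_Ioo]
        congr 2
        ext t
        simp only [mem_inter_iff, mem_Ioo, mem_Iio]
        exact ⟨fun ht => ⟨ht.1.1, ht.2⟩, fun ht => ⟨⟨ht.1, ht.2.trans hz.2⟩, ht.2⟩⟩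
      · refine ((h.integrable_mul hb).comp_snd _).bdd_mul (c := A) ?_
          (Eventually.of_forall fun w => ?_)
        · exact ((hα.continuous.measurable.comp measurable_fst).mul (Measurable.ite
            (measurableSet_lt measurable_fst (measurable_fst.comp measurable_snd))
            measurable_const measurable_const)).aestronglyMeasurable
        · rw [norm_mul]
          exact (mul_le_of_le_one_right (norm_nonneg _) (norm_ite_le _)).trans (hA _)
    have h1 : Integrable (fun t => α t * ∫ x, V (t, x) * b x) (volume.restrict (Ioo 0 T)) :=
      hi1.bdd_mul hα.continuous.aestronglyMeasurable (Eventually.of_forall hA)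
    have h2 : Integrable (fun t => α t * slicePairing ρ v b t) (volume.restrict (Ioo 0 T)) :=
      hi2.bdd_mul hα.continuous.aestronglyMeasurable (Eventually.of_forall hA)
    simp only [Pi.sub_apply, smul_eq_mul, mul_sub]
    rw [integral_sub h1 h2, e1, e2, sub_self]

/-- For almost every time, the slice of `V` has the prescribed pairing with all smooth functions at
once, by separability. -/
lemma ae_slice_forall_eq (h : IsWeakCompetitor T ρ v V C) :
    ∀ᵐ t ∂(volume.restrict (Ioo 0 T)), Integrable (fun x => V (t, x)) ∧
      ∀ b, TorusSmooth b → ∫ x, V (t, x) * b x = slicePairing ρ v b t := by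
  let S := {b : C(UnitAddCircle, ℝ) // TorusSmooth b}
  have : Nonempty S := ⟨⟨0, torusSmooth_zero⟩⟩
  filter_upwards [h.integrable_potential.prod_right_ae,
    ae_all_iff.2 fun n => h.ae_slice_eq (TopologicalSpace.denseSeq S n).2] with t ht1 ht2
  refine ⟨ht1, fun b hb => ?_⟩
  have hc1 : Continuous fun b : S => ∫ x, V (t, x) * b.1 x := by
    have := (continuous_integral_comp_mul measurable_id ht1).comp
      (continuous_subtype_val (p := fun b : C(UnitAddCircle, ℝ) => TorusSmooth b))
    exact this.congr fun b => by simp [mul_comm]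
  have hg : Integrable (fun z : ℝ × UnitAddCircle => (if t < z.1 then (1 : ℝ) else 0) * v z) ρ :=
    h.integrable_velocity.bdd_mul (c := 1) (measurable_after t).aestronglyMeasurable
      (Eventually.of_forall fun _ => norm_ite_le _)
  have hc2 : Continuous fun b : S => slicePairing ρ v b.1 t := by
    have := ((continuous_integral_comp_mul measurable_snd hg).comp
      (continuous_subtype_val (p := fun b : C(UnitAddCircle, ℝ) => TorusSmooth b))).neg
    refine this.congr fun b => ?_
    simp only [slicePairing, Pi.neg_apply, Function.comp_apply, mul_left_comm]
  have := Continuous.ext_on (TopologicalSpace.denseRange_denseSeq S) hc1 hc2 (by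
    rintro _ ⟨n, rfl⟩
    exact ht2 n)
  exact congrFun this ⟨⟨b, hb.continuous⟩, hb⟩

lemma abs_slicePairing_le (hT : 0 < T) (h : IsWeakCompetitor T ρ v V C) {b : UnitAddCircle → ℝ}
    (hb : TorusSmooth b) {t : ℝ} (ht : t ∈ Icc 0 T) :
    |slicePairing ρ v b t| ≤ |C| * √(∫ x, b x ^ 2) := by
  refine le_of_ae_le_of_continuous hT (h.continuous_slicePairing hb).abs ?_ ht
  filter_upwards [h.ae_bound, h.ae_slice_forall_eq] with t ht1 ht2
  rw [← ht2.2 b hb, ← Real.sqrt_sq_eq_abs C, ← Real.sqrt_mul (sq_nonneg C)]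
  refine Real.abs_le_sqrt ?_
  have hb2 : MemLp b 2 := by
    obtain ⟨D, -, hD⟩ := hb.exists_bound
    exact MemLp.of_bound hb.continuous.aestronglyMeasurable D (Eventually.of_forall hD)
  have hV2 : MemLp (fun x => V (t, x)) 2 := MemLp.of_bound ht2.1.1 C ht1
  have hVC : ∫ x, V (t, x) ^ 2 ≤ C ^ 2 := by
    have : ∫ x, V (t, x) ^ 2 ≤ ∫ _ : UnitAddCircle, C ^ 2 := by
      refine integral_mono_ae hV2.integrable_sq (integrable_const _) ?_
      filter_upwards [ht1] with x hx
      rw [← sq_abs]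
      exact pow_le_pow_left₀ (abs_nonneg _) hx 2
    simpa using this
  have := sq_integral_mul_le' hb2 hV2
  simp only [mul_comm (b _)] at this
  exact this.trans (mul_le_mul_of_nonneg_right hVC (integral_nonneg fun x => sq_nonneg _))

/-- At every time there is a slice with the prescribed pairings. -/
lemma exists_slice (hT : 0 < T) (h : IsWeakCompetitor T ρ v V C) {t : ℝ} (ht : t ∈ Icc 0 T) :
    ∃ w : UnitAddCircle → ℝ, Integrable w ∧
      ∀ b, TorusSmooth b → ∫ x, w x * b x = slicePairing ρ v b t := by
  let E : Submodule ℝ (UnitAddCircle → ℝ) :=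
    { carrier := {b | TorusSmooth b}
      add_mem' := fun hf hg => TorusSmooth.add hf hg
      zero_mem' := torusSmooth_zero
      smul_mem' := fun c f hf => TorusSmooth.smul c hf }
  let L : E →ₗ[ℝ] ℝ :=
    { toFun := fun b => slicePairing ρ v b.1 t
      map_add' := fun f g => by
        simp only [slicePairing]
        rw [← neg_add, ← integral_add (h.integrable_after_mul f.2 t) (h.integrable_after_mul g.2 t)]
        simp [add_mul, mul_add]
      map_smul' := fun c f => by
        simp only [slicePairing]
        rw [RingHom.id_apply, smul_eq_mul, mul_neg, ← integral_const_mul]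
        congr 2
        ext z
        simp only [Submodule.coe_smul, Pi.smul_apply, smul_eq_mul]
        ring }
  obtain ⟨w, hw, -, hwL⟩ := exists_forall_eq_integral_mul (μ := (volume : Measure UnitAddCircle))
    L E.subtype (fun b => by
      obtain ⟨D, -, hD⟩ := b.2.exists_bound
      exact MemLp.of_bound b.2.continuous.aestronglyMeasurable D (Eventually.of_forall hD))
    (abs_nonneg C) fun b => h.abs_slicePairing_le hT b.2 ht
  refine ⟨w, hw.integrable one_le_two, fun b hb => ?_⟩
  have := hwL ⟨b, hb⟩
  simp only [mul_comm (w _)]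
  exact this.symm

/-- A representative of `V` all of whose time slices have the prescribed pairings. -/
lemma exists_representative (hT : 0 < T) (h : IsWeakCompetitor T ρ v V C) :
    ∃ W : ℝ → UnitAddCircle → ℝ, (∀ᵐ z ∂(slab T), W z.1 z.2 = V z) ∧ W T = 0 ∧
      ∀ t ∈ Icc 0 T, Integrable (W t) ∧
        ∀ b, TorusSmooth b → ∫ x, W t x * b x = slicePairing ρ v b t := by
  set G : ℝ → Prop := fun t => t ∈ Ioo 0 T ∧ Integrable (fun x => V (t, x)) ∧
      ∀ b, TorusSmooth b → ∫ x, V (t, x) * b x = slicePairing ρ v b t with hG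
  have hslice : ∀ t, ∃ w : UnitAddCircle → ℝ, (G t → w = fun x => V (t, x)) ∧ (t = T → w = 0) ∧
      (t ∈ Icc 0 T → Integrable w ∧
        ∀ b, TorusSmooth b → ∫ x, w x * b x = slicePairing ρ v b t) := by
    intro t
    by_cases htT : t = T
    · refine ⟨0, fun hg => absurd hg.1.2 (by simp [htT]), fun _ => rfl, fun _ =>
        ⟨integrable_zero _ _ _, fun b _ => ?_⟩⟩
      rw [htT, h.slicePairing_final]
      simp
    by_cases hg : G t
    · exact ⟨fun x => V (t, x), fun _ => rfl, fun h' => absurd h' htT, fun _ => hg.2⟩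
    by_cases ht : t ∈ Icc 0 T
    · obtain ⟨w, hw⟩ := h.exists_slice hT ht
      exact ⟨w, fun h' => absurd h' hg, fun h' => absurd h' htT, fun _ => hw⟩
    · exact ⟨0, fun h' => absurd h' hg, fun h' => absurd h' htT, fun h' => absurd h' ht⟩
  choose W hW1 hW2 hW3 using hslice
  refine ⟨W, ?_, hW2 T rfl, hW3⟩
  have hae : ∀ᵐ t ∂(volume.restrict (Ioo 0 T)), G t := by
    filter_upwards [h.ae_slice_forall_eq, ae_restrict_mem measurableSet_Ioo] with t ht1 ht2
      using ⟨ht2, ht1⟩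
  filter_upwards [Measure.quasiMeasurePreserving_fst.ae hae] with z hz
  rw [hW1 z.1 hz]

lemma inter_ae_eq {μ : Measure (ℝ × UnitAddCircle)} (hμ : ∀ᵐ z ∂μ, z.1 ∈ Ioo 0 T)
    (s : Set (ℝ × UnitAddCircle)) : (s ∩ Ioo 0 T ×ˢ univ : Set _) =ᵐ[μ] s := by
  filter_upwards [hμ] with z hz
  have : (z ∈ s ∩ Ioo 0 T ×ˢ univ) = (z ∈ s) := by simp [hz.1, hz.2]
  exact this

/-- A weak limit of smooth competitors defines a generalized competitor. -/
lemma exists_bvCompetitor (hT : 0 < T) (h : IsWeakCompetitor T ρ v V C) :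
    ∃ W, BVCompetitor T W (ρ.withDensityᵥ v) ((slab T).toSignedMeasure - ρ.toSignedMeasure) := by
  obtain ⟨W, hWV, hWT, hW⟩ := h.exists_representative hT
  have hS := measurableSet_Ioo_prod T
  refine ⟨W, h.integrable_potential.congr ?_, fun t ht => (hW t ht).1, ⟨?_, fun φ hφ => ?_⟩,
    ⟨?_, fun φ hφ => ?_⟩, fun ψ hψ => ?_, ?_, ?_⟩
  · filter_upwards [hWV] with z hz using hz.symm
  · ext s hs
    rw [VectorMeasure.restrict_apply _ hS hs, withDensityᵥ_apply h.integrable_velocity (hs.inter hS),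
      withDensityᵥ_apply h.integrable_velocity hs, setIntegral_congr_set (inter_ae_eq h.ae_mem s)]
  · have hφc := continuous_of_contDiff_lift hφ.smooth
    obtain ⟨D, hD⟩ := hφc.bounded_above_of_compact_support hφ.compact
    rw [integral_withDensityᵥ h.integrable_velocity hφc.aestronglyMeasurable hD, h.time φ hφ]
    congr 1
    refine integral_congr_ae ?_
    filter_upwards [hWV] with z hz
    rw [hz]
  · ext s hs
    rw [VectorMeasure.restrict_apply _ hS hs, _root_.sub_apply, _root_.sub_apply,
      Measure.toSignedMeasure_apply_measurable (hs.inter hS),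
      Measure.toSignedMeasure_apply_measurable (hs.inter hS),
      Measure.toSignedMeasure_apply_measurable hs, Measure.toSignedMeasure_apply_measurable hs,
      measureReal_congr (inter_ae_eq h.ae_mem s), measureReal_congr (inter_ae_eq (ae_slab_mem T) s)]
  · have hφc := continuous_of_contDiff_lift hφ.smooth
    have hi : ∀ (μ : Measure (ℝ × UnitAddCircle)) [IsFiniteMeasure μ], Integrable φ μ := fun μ _ => by
      obtain ⟨D, hD⟩ := hφc.bounded_above_of_compact_support hφ.compact
      exact Integrable.of_bound hφc.aestronglyMeasurable D (Eventually.of_forall hD)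
    rw [integral_sub_toSignedMeasure (hi _) (hi _), h.space φ hφ]
    congr 1
    refine integral_congr_ae ?_
    filter_upwards [hWV] with z hz
    rw [hz]
  · exact (isCompact_Icc.uniformContinuousOn_of_continuous
      (h.continuous_slicePairing hψ).continuousOn).congr fun t ht => ((hW t ht).2 ψ hψ).symm
  · rw [sub_le_self_iff]
    exact Measure.zero_le_toSignedMeasure _
  · rw [hWT]

end IsWeakCompetitor

/-! ### Existence of a maximizer -/

lemma smoothCompetitor_zero (T : ℝ) : SmoothCompetitor T fun _ _ => 0 where
  smooth := contDiffOn_const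
  final _ := rfl
  deriv_le t _ x := by simp [torusDeriv]
  deriv_eq t _ x _ := by simp

lemma zero_le_optimalValue' (T : ℝ) (u₀ : UnitAddCircle → ℝ) : 0 ≤ optimalValue' T u₀ := by
  have h := smoothObjective'_le (u₀ := u₀) (smoothCompetitor_zero T)
  simpa [smoothObjective', smoothAction, torusDeriv] using h

lemma smoothObjective'_eq_coe {T : ℝ} {W : ℝ → UnitAddCircle → ℝ} (hA : smoothAction T W ≠ ⊤)
    (u₀ : UnitAddCircle → ℝ) : smoothObjective' T u₀ W = ((-(smoothAction T W).toReal +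
      ∫ z : ℝ × UnitAddCircle, u₀ z.2 * derivWithin (fun s => W s z.2) (Icc 0 T) z.1 ∂(slab T) : ℝ)
        : EReal) := by
  have h : ((smoothAction T W : ℝ≥0∞) : EReal) = (((smoothAction T W).toReal : ℝ) : EReal) :=
    (EReal.coe_ennreal_toReal hA).symm
  rw [smoothObjective', h]
  simp only [mul_comm, EReal.coe_add, EReal.coe_neg]

lemma smoothAction_ne_top {T : ℝ} {W : ℝ → UnitAddCircle → ℝ} {u₀ : UnitAddCircle → ℝ}
    (h : smoothObjective' T u₀ W ≠ ⊥) : smoothAction T W ≠ ⊤ := by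
  intro htop
  refine h ?_
  simp [smoothObjective', htop]

/-- The linear term is controlled by half of the action, so that maximizing sequences have bounded
action. -/
lemma SmoothCompetitor.integral_mul_timeDeriv_le {T : ℝ} (hT : 0 < T) {W : ℝ → UnitAddCircle → ℝ}
    (hW : SmoothCompetitor T W) (hA : smoothAction T W ≠ ⊤) {u₀ : UnitAddCircle → ℝ}
    (hu₀ : TorusSmooth u₀) {D : ℝ} (hD : ∀ x, |u₀ x| ≤ D) :
    ∫ z : ℝ × UnitAddCircle, u₀ z.2 * derivWithin (fun s => W s z.2) (Icc 0 T) z.1 ∂(slab T)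
      ≤ (smoothAction T W).toReal / 2 + D ^ 2 * T := by
  have := hW.isFiniteMeasure_massMeasure hT
  rw [← hW.integral_massMeasure_velocity hT]
  have hv := hW.memLp_velocity hT hA
  have hle : ∫ z, u₀ z.2 * velocity T W z ∂(massMeasure T W)
      ≤ ∫ z, (velocity T W z ^ 2 / 4 + D ^ 2) ∂(massMeasure T W) := by
    refine integral_mono ((hv.integrable one_le_two).bdd_mul (c := D)
      hu₀.continuous.snd'.aestronglyMeasurable (Eventually.of_forall fun z => hD z.2))
      ((hv.integrable_sq.div_const 4).add (integrable_const _)) fun z => ?_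
    have h2 : u₀ z.2 ^ 2 ≤ D ^ 2 := sq_le_sq' (_root_.abs_le.1 (hD z.2)).1 (_root_.abs_le.1 (hD z.2)).2
    simp only
    nlinarith [sq_nonneg (velocity T W z / 2 - u₀ z.2)]
  rw [integral_add (hv.integrable_sq.div_const 4) (integrable_const _), integral_div,
    hW.integral_velocity_sq hT hA, integral_const, hW.massMeasure_real_univ hT, smul_eq_mul] at hle
  linarith

lemma exists_optimalValue'_eq_coe {T : ℝ} (hT : 0 < T) {u₀ : UnitAddCircle → ℝ}
    (hu₀ : TorusSmooth u₀) : ∃ j : ℝ, optimalValue' T u₀ = (j : EReal) := by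
  obtain ⟨D, -, hD⟩ := hu₀.exists_bound
  have hle : optimalValue' T u₀ ≤ ((D ^ 2 * T : ℝ) : EReal) := by
    refine sSup_le ?_
    rintro _ ⟨W, hW, rfl⟩
    by_cases hbot : smoothObjective' T u₀ W = ⊥
    · rw [hbot]
      exact bot_le
    · have hA := smoothAction_ne_top hbot
      rw [smoothObjective'_eq_coe hA, EReal.coe_le_coe_iff]
      have h1 := hW.integral_mul_timeDeriv_le hT hA hu₀ hD
      have h2 : 0 ≤ (smoothAction T W).toReal := ENNReal.toReal_nonneg
      linarith
  refine ⟨(optimalValue' T u₀).toReal, (EReal.coe_toReal ?_ ?_).symm⟩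
  · exact ne_top_of_le_ne_top (EReal.coe_ne_top _) hle
  · exact ne_bot_of_le_ne_bot EReal.zero_ne_bot (zero_le_optimalValue' T u₀)

/-- A weak limit of a maximizing sequence of smooth competitors is optimal. -/
lemma exists_optimalValue_le_bvObjective {T : ℝ} (hT : 0 < T) {u₀ : UnitAddCircle → ℝ}
    (hu₀ : TorusSmooth u₀) :
    ∃ W q p, BVCompetitor T W q p ∧ optimalValue T u₀ ≤ bvObjective T u₀ W q p := by
  obtain ⟨D, -, hD⟩ := hu₀.exists_bound
  obtain ⟨j, hj⟩ := exists_optimalValue'_eq_coe hT hu₀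
  have hseq : ∀ n : ℕ, ∃ W, SmoothCompetitor T W ∧
      ((j - 1 / (n + 1) : ℝ) : EReal) < smoothObjective' T u₀ W := fun n => by
    have hlt : ((j - 1 / (n + 1) : ℝ) : EReal) < optimalValue' T u₀ := by
      rw [hj, EReal.coe_lt_coe_iff]
      have : (0 : ℝ) < 1 / (n + 1) := Nat.one_div_pos_of_nat
      linarith
    obtain ⟨_, ⟨W, hW, rfl⟩, h⟩ := lt_sSup_iff.1 hlt
    exact ⟨W, hW, h⟩
  choose W hW hlt using hseq
  have hfin : ∀ n, smoothAction T (W n) ≠ ⊤ := fun n =>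
    smoothAction_ne_top (ne_bot_of_gt (hlt n))
  have hlt' : ∀ n : ℕ, j - 1 / (n + 1) < -(smoothAction T (W n)).toReal + ∫ z : ℝ × UnitAddCircle,
      u₀ z.2 * derivWithin (fun s => W n s z.2) (Icc 0 T) z.1 ∂(slab T) := fun n => by
    have := hlt n
    rwa [smoothObjective'_eq_coe (hfin n), EReal.coe_lt_coe_iff] at this
  have hj0 : 0 ≤ j := by
    have := zero_le_optimalValue' T u₀
    rwa [hj, EReal.coe_nonneg] at this
  obtain ⟨ρ, hρ, v, V, C, A, h, hA, hvA, hlim⟩ := exists_weakCompetitor hT (hyperfilter ℕ) hW hfin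
    (M := 2 * (D ^ 2 * T + 1)) fun n => by
      have h1 := hlt' n
      have h2 := (hW n).integral_mul_timeDeriv_le hT (hfin n) hu₀ hD
      have h3 : (1 : ℝ) / (n + 1) ≤ 1 := by
        rw [div_le_one (by positivity)]
        linarith [n.cast_nonneg (α := ℝ)]
      linarith
  have hL := hlim (BoundedContinuousFunction.ofNormedAddCommGroup
    (fun z : ℝ × UnitAddCircle => u₀ z.2) hu₀.continuous.snd' D fun z => hD z.2)
  simp only [BoundedContinuousFunction.coe_ofNormedAddCommGroup] at hL
  have hn : Tendsto (fun n : ℕ => j - 1 / ((n : ℝ) + 1)) (hyperfilter ℕ) (𝓝 j) := by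
    have := (tendsto_one_div_add_atTop_nhds_zero_nat (𝕜 := ℝ)).const_sub j
    rw [sub_zero] at this
    exact this.mono_left Nat.hyperfilter_le_atTop
  have hle := le_of_tendsto_of_tendsto' hn (hA.neg.add hL) fun n => (hlt' n).le
  obtain ⟨W', hW'⟩ := h.exists_bvCompetitor hT
  refine ⟨W', _, _, hW', ?_⟩
  have hv := h.integrable_velocity
  have hact : measureAction ((slab T).toSignedMeasure
      - ((slab T).toSignedMeasure - ρ.toSignedMeasure)) (ρ.withDensityᵥ v)
      = ENNReal.ofReal (∫ z, v z ^ 2 / 2 ∂ρ) := by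
    rw [measureAction_eq (sub_sub_cancel _ _).symm hv rfl, ofReal_integral_eq_lintegral_ofReal
      (h.memLp.integrable_sq.div_const 2) (Eventually.of_forall fun z => by positivity)]
  rw [← hW'.bvObjective'_eq hT hu₀, ← optimalValue'_eq hT hu₀, hj, bvObjective', hact,
    integral_withDensityᵥ hv hu₀.continuous.snd'.aestronglyMeasurable fun z => hD z.2,
    EReal.coe_ennreal_ofReal, max_eq_left (integral_nonneg fun z => by positivity),
    ← EReal.coe_neg, ← EReal.coe_add, EReal.coe_le_coe_iff]
  linarith

end BurgersMax

theorem mainTheorem5 (T : ℝ) (hT : 0 < T) (u₀ : UnitAddCircle → ℝ)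
    (hu₀ : BurgersMax.TorusSmooth u₀) :
    -- every smooth competitor belongs to the generalized class, with the same objective
    (∀ W, BurgersMax.SmoothCompetitor T W →
      ∃ q p, BurgersMax.BVCompetitor T W q p ∧
        BurgersMax.bvObjective T u₀ W q p = BurgersMax.smoothObjective T u₀ W) ∧
    -- the two forms of the problem are equivalent, in both classes
    BurgersMax.optimalValue' T u₀ = BurgersMax.optimalValue T u₀ ∧
    (∀ W q p, BurgersMax.BVCompetitor T W q p →
      BurgersMax.bvObjective' T u₀ q p = BurgersMax.bvObjective T u₀ W q p) ∧
    -- the value of the smooth problem is the maximum over the generalized class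
    IsGreatest {c : EReal | ∃ W q p, BurgersMax.BVCompetitor T W q p ∧
      c = BurgersMax.bvObjective T u₀ W q p} (BurgersMax.optimalValue T u₀) := by
  refine ⟨fun W hW => ⟨_, _, hW.bvCompetitor hT, hW.bvObjective_eq hT⟩,
    BurgersMax.optimalValue'_eq hT hu₀, fun W q p hW => hW.bvObjective'_eq hT hu₀, ?_, ?_⟩
  · obtain ⟨W, q, p, hW, h⟩ := BurgersMax.exists_optimalValue_le_bvObjective hT hu₀
    exact ⟨W, q, p, hW, le_antisymm h (hW.bvObjective_le hT hu₀)⟩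
  · rintro _ ⟨W, q, p, hW, rfl⟩
    exact hW.bvObjective_le hT hu₀
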